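/- **Setting.** Let $(\mathcal S,\mathcal A,P,r,\gamma)$ be a discounted Markov decision process with measurable state space $\mathcal S$, discount $\gamma\in(0,1)$, action set $\mathcal A\subset\mathbb R^d$ measurable, convex and bounded, and bounded measurable reward $r$. Let $\tau>0$. For a probability law $q$ on $\mathcal A$ with Lebesgue density write $\mathcal H(q)=\int q\log q$ (and $\mathcal H(q)=+\infty$ if $q$ has no density). A policy is a Markov kernel $\pi(\cdot\mid s)$ from $\mathcal S$ to $\mathcal A$, with densities and with $\mathcal H^\pi(s):=\mathcal H(\pi(\cdot\mid s))$ bounded in $s$. Put $$V_\tau^\pi(s)=\sum_{t\ge0}\gamma^t\,\mathbb E^\pi\big[r(s_t,a_t)-\tau\mathcal H^\pi(s_t)\mid s_0=s\big],\qquad Q^\pi(s,a)=r(s,a)+\gamma\int V_\tau^\pi(s')\,P(ds'\mid s,a).$$ Let $\pi^*$ be an optimal policy ($V_\tau^{\pi^*}\ge V_\tau^\pi$ pointwise for every policy $\pi$), let $\nu^*$ be a stationary distribution of the state process under $\pi^*$, and put $$J(\pi)=\mathbb E_{s\sim\nu^*}[V_\tau^\pi(s)],\qquad \mathcal D(\pi,\pi^*)=\mathbb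 E_{s\sim\nu^*}\big[\tfrac12W_2^2(\pi(\cdot\mid s),\pi^*(\cdot\mid s))\big].$$ **Algorithm.** Starting from a policy $\pi_0$ and with a constant step size $\eta$, the (random) policies $\pi_k$, which depend on the noise $\xi_{0:k-1}=(\xi_0,\dots,\xi_{k-1})$, satisfy almost surely, for all $k\ge 0$ and $s\in\mathcal S$, $$\pi_{k+1}(\cdot\mid s)\in\arg\max_{q}\Big\{\langle Q^{\pi_k,\xi_k}(s,\cdot),q\rangle-\tau\mathcal H(q)-\tfrac1{2\eta}W_2^2\big(q,\pi_k(\cdot\mid s)\big)\Big\},$$ the maximum being over probability laws $q$ on $\mathcal A$. Here $Q^{\pi_k,\xi_k}$ is a stochastic estimator of $Q^{\pi_k}$, built from $\xi_{0:k}$. **Assumptions.** 1. There is $\lambda>0$ such that, almost surely, for all $k\ge 0$ and all $s$ the law $\mu=\pi_k(\cdot\mid s)$ satisfies $T_2(\lambda)$: $W_2^2(\nu,\mu)\le\frac2\lambda\mathrm{KL}(\nu\|\mu)$ for all $\nu\in\mathcal P_2(\mathbb R^d)$. 2. $Q^{\pi_k,\xi_k}(s,\cdot)$ and $Q^{\pi_k}(s,\cdot)$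 are differentiable on $\mathcal A$ and, with $\mathbb E_{\xi_k}$ the expectation over $\xi_k$ given $\xi_{0:k-1}$ and $\bar Q^{\pi_k}:=\mathbb E_{\xi_k}[Q^{\pi_k,\xi_k}]$, for all $k\ge 0$ $$\|\bar Q^{\pi_k}-Q^{\pi_k}\|_\infty\le\epsilon_k\le\epsilon,\qquad \mathbb E_{\xi_k}\Big[\sup_{(s,a)\in\mathcal S\times\mathcal A}\|\nabla_aQ^{\pi_k,\xi_k}(s,a)-\nabla_aQ^{\pi_k}(s,a)\|_2^2\Big]\le\sigma_k^2,\quad 0\le\sigma_k\le\sigma .$$ 3. $|Q^{\pi_k,\xi_k}|\le B$ on $\mathcal S\times\mathcal A$ for all $k\ge 0$. **Conclusion.** Let $\eta=\frac1{\gamma\lambda\tau}$ (or, more generally, let $\eta\ge\frac1{\gamma\lambda\tau}$). There is a constant $C\ge0$, depending only on $\gamma,\tau,\lambda,\eta,B$, such that, with $\Delta_0:=J(\pi^*)-J(\pi_0)+\lambda\tau\,\mathcal D(\pi_0,\pi^*)<\infty$, for every $k\ge0$ $$\mathbb E_{\xi_{0:k-1}}\big[J(\pi^*)-J(\pi_k)+\lambda\tau\,\mathcal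 D(\pi_k,\pi^*)\big]\le\gamma^k\Delta_0+C(\epsilon+\sigma).$$ Consequently, for every $\delta>0$, the left-hand side is at most $\delta+C(\epsilon+\sigma)$ as soon as $k\ge\frac1{1-\gamma}\log\frac{\Delta_0}{\delta}$. -/

import Mathlib

open MeasureTheory ProbabilityTheory Set
open scoped ENNReal

noncomputable section

namespace WPPG

/-- The ambient space `ℝ^d` of actions, with its Euclidean norm. -/
abbrev Act (d : ℕ) : Type := EuclideanSpace ℝ (Fin d)

section Transport

variable {d : ℕ}

/-- Squared 2-Wasserstein distance: the infimum of `∫ ‖x - y‖² dΓ` over all couplings `Γ`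
of `μ` and `ν`. -/
def W2sq (μ ν : Measure (Act d)) : ℝ≥0∞ :=
  ⨅ (Γ : Measure (Act d × Act d)) (_ : Γ.map Prod.fst = μ ∧ Γ.map Prod.snd = ν),
    ∫⁻ z, edist z.1 z.2 ^ 2 ∂Γ

/-- Membership in `𝒫₂(ℝ^d)`: probability measures with finite second moment. -/
def IsP2 (μ : Measure (Act d)) : Prop :=
  IsProbabilityMeasure μ ∧ ∫⁻ x, ‖x‖ₑ ^ 2 ∂μ < ∞

/-- The transportation-information inequality `T₂(lam)`:
`W₂²(ν, μ) ≤ (2 / lam) KL(ν ‖ μ)` for every `ν ∈ 𝒫₂(ℝ^d)`. -/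
def SatisfiesT2 (lam : ℝ) (μ : Measure (Act d)) : Prop :=
  IsP2 μ ∧ ∀ ν : Measure (Act d), IsP2 ν →
    W2sq ν μ ≤ ENNReal.ofReal (2 / lam) * InformationTheory.klDiv ν μ

/-- Logarithm of the Lebesgue density of `q`. -/
def logDensity (q : Measure (Act d)) (a : Act d) : ℝ :=
  Real.log (q.rnDeriv volume a).toReal

/-- The negative entropy `H(q) = ∫ q(a) log q(a) da`, written as an integral against `q`. -/
def negEntropy (q : Measure (Act d)) : ℝ := ∫ a, logDensity q a ∂q

/-- Probability distributions on the action set `A` with a Lebesgue density and a finite entropy.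
On a bounded `A` the functional `H` takes values in `(-∞, ∞]` on all probability measures on `A`
(with value `∞` off the absolutely continuous ones), and these are the ones where it is finite. -/
structure IsActionLaw (A : Set (Act d)) (q : Measure (Act d)) : Prop where
  isProb : IsProbabilityMeasure q
  supported : q Aᶜ = 0
  hasDensity : q ≪ volume
  finiteEntropy : Integrable (logDensity q) q

/-- The per-state proximal objective
`⟨f, q⟩ - τ H(q) - W₂²(q, μ) / (2 η)`. -/
def proxObjective (τ η : ℝ) (f : Act d → ℝ) (μ q : Measure (Act d)) : ℝ :=
  ∫ a, f a ∂q - τ * negEntropy q - 1 / (2 * η) * (W2sq q μ).toReal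

/-- `q` maximizes the proximal objective over the distributions on `A`. Distributions of
infinite entropy have objective `-∞`, hence are not listed among the competitors. -/
def IsProxStep (A : Set (Act d)) (τ η : ℝ) (f : Act d → ℝ) (μ q : Measure (Act d)) : Prop :=
  IsActionLaw A q ∧ ∀ p, IsActionLaw A p →
    proxObjective τ η f μ p ≤ proxObjective τ η f μ q

/-- `‖∇ₐ f - ∇ₐ g‖_{2,∞}`: the supremum over `S × A` of the Euclidean norm of the difference of
the action-gradients, the gradients being taken within the action set `A`. -/
def gradSupDist {S : Type*} (A : Set (Act d)) (f g : S → Act d → ℝ) : ℝ≥0∞ :=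
  ⨆ (s : S) (a ∈ A), ‖gradientWithin (f s) A a - gradientWithin (g s) A a‖ₑ

end Transport

/-- The data of a Markov decision process with measurable state space `S` and action set
`actions ⊆ ℝ^d`. The transition kernel and the reward are given on all of `S × ℝ^d`, but their
values at `(s, a)` with `a ∉ actions` play no role. -/
structure MDP (S : Type*) [MeasurableSpace S] (d : ℕ) where
  actions : Set (Act d)
  measurableSet_actions : MeasurableSet actions
  trans : Kernel (S × Act d) S
  isMarkov_trans : IsMarkovKernel trans
  reward : S × Act d → ℝ
  measurable_reward : Measurable reward

namespace MDP

variable {S : Type*} [MeasurableSpace S] {d : ℕ} (M : MDP S d)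

/-- The admissible policies: Markov kernels from states to distributions on the action set, with
densities and with entropy bounded uniformly over the states. -/
def IsPolicy (π : Kernel S (Act d)) : Prop :=
  (∀ s, IsActionLaw M.actions (π s)) ∧ ∃ B : ℝ, ∀ s, |negEntropy (π s)| ≤ B

/-- The one-step state transition kernel under `π`: `s ↦ a ∼ π(· ∣ s) ↦ s' ∼ P(· ∣ s, a)`. -/
def stateStep (π : Kernel S (Act d)) : Kernel S S :=
  M.trans ∘ₖ (Kernel.id ×ₖ π)

/-- `M.stateLaw π t s` is the law of the state `s_t` under `π`, started at `s_0 = s`. -/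
def stateLaw (π : Kernel S (Act d)) : ℕ → Kernel S S
  | 0 => Kernel.id
  | t + 1 => M.stateStep π ∘ₖ stateLaw π t

/-- The entropy-regularized value function
`V_τ^π(s) = ∑_t γ^t E^π[r(s_t, a_t) - τ H^π(s_t) ∣ s_0 = s]`. -/
def value (γ τ : ℝ) (π : Kernel S (Act d)) (s : S) : ℝ :=
  ∑' t : ℕ, γ ^ t *
    ∫ s', ((∫ a, M.reward (s', a) ∂(π s')) - τ * negEntropy (π s')) ∂(M.stateLaw π t s)

/-- The soft Q-function `Q_τ^π(s, a) = r(s, a) + γ E[V_τ^π(s') ∣ s, a]`. -/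
def qValue (γ τ : ℝ) (π : Kernel S (Act d)) (s : S) (a : Act d) : ℝ :=
  M.reward (s, a) + γ * ∫ s', M.value γ τ π s' ∂(M.trans (s, a))

/-- `πs` is an optimal policy: it is admissible and `V_τ^{πs} ≥ V_τ^π` at every state for every
admissible policy `π`. -/
def IsOptimal (γ τ : ℝ) (πs : Kernel S (Act d)) : Prop :=
  M.IsPolicy πs ∧ ∀ π, M.IsPolicy π → ∀ s, M.value γ τ π s ≤ M.value γ τ πs s

/-- `νs` is a stationary distribution of the state process under `π`. -/
def IsStationary (π : Kernel S (Act d)) (νs : Measure S) : Prop :=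
  IsProbabilityMeasure νs ∧ Kernel.Invariant (M.stateStep π) νs

/-- The performance `J(π) = E_{s ∼ νs}[V_τ^π(s)]`. -/
def perf (γ τ : ℝ) (νs : Measure S) (π : Kernel S (Act d)) : ℝ :=
  ∫ s, M.value γ τ π s ∂νs

/-- `D(π, π') = E_{s ∼ νs}[(1/2) W₂²(π(· ∣ s), π'(· ∣ s))]`. -/
def policyDist (νs : Measure S) (π π' : Kernel S (Act d)) : ℝ≥0∞ :=
  ∫⁻ s, 2⁻¹ * W2sq (π s) (π' s) ∂νs

/-- The Lyapunov gap `J(πs) - J(π) + lam τ D(π, πs)`. For an optimal `πs` and an admissible `π`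
both terms are nonnegative. -/
def gap (γ τ lam : ℝ) (νs : Measure S) (πs π : Kernel S (Act d)) : ℝ≥0∞ :=
  ENNReal.ofReal (M.perf γ τ νs πs - M.perf γ τ νs π)
    + ENNReal.ofReal (lam * τ) * policyDist νs π πs

end MDP

/-- The history `(ξ_0, …, ξ_{k-1}, ξ)` obtained from `h = (ξ_0, …, ξ_{k-1})`. -/
def histSnoc {Ξ : Type*} {k : ℕ} (h : Fin k → Ξ) (ξ : Ξ) : Fin (k + 1) → Ξ :=
  Fin.snoc (α := fun _ => Ξ) h ξ

/-- The law of the sampling history `ξ_{0:k-1} = (ξ_0, …, ξ_{k-1})`, where, given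
`ξ_{0:k-1} = h`, the noise `ξ_k` is drawn from `κ k h`. -/
def histLaw {Ξ : Type*} [MeasurableSpace Ξ] (κ : (k : ℕ) → Kernel (Fin k → Ξ) Ξ) :
    (k : ℕ) → Measure (Fin k → Ξ)
  | 0 => Measure.dirac (fun i => i.elim0)
  | k + 1 => ((histLaw κ k) ⊗ₘ (κ k)).map (fun p => histSnoc p.1 p.2)

end WPPG

end

/-! The gap is a Lyapunov function: each exact update contracts it by `γ`, and an inexact one adds
an error linear in `ε + σ`.

Along linear mixtures the functional `⟨f, q⟩` is linear, `W₂²(q, μ)` is convex, and the Jensen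
defect of `H` on `(1 - t) r + t q` is at least `t KL(q ‖ (1 - t) r + t q)`. Comparing a maximizer
`r` with these mixtures and letting `t → 0` shows that the proximal objective at `q` lies at least
`τ KL(q ‖ r)` below its maximum. `T₂(lam)` at `r` turns this into `(lam τ / 2) W₂²(q, r)`
(`IsProxStep.add_W2sq_le`). No geodesic convexity of `Q` is needed.

With `q = π*` this is a three-point inequality: `(lam τ / 2) W₂²(π', π*)` is at most `W₂²(π, π*) /
(2 η)` plus the difference of the Bellman images of `V^π` under `π'` and under `π*`. Averaged over
`ν*`, the image under `π*` is governed by stationarity (`perf_sub_perf_eq`), and the image under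
`π'` is, up to error, at most `V^{π'}` by policy improvement (`bellman_sub_le_value`). The
performance part thus contracts by `γ`; the distance part does so because `1 / η ≤ γ lam τ`
(`gap_step`).

The estimation error `δ = f - Q` is integrated against three laws. Against `π` and `π*`, which are
fixed before the noise is drawn, only the bias survives averaging. Against `π'`, which depends on
the noise, the difference `δ(π') - δ(π)` is absorbed by the proximal term `W₂²(π', π) / (2 η)` at
the price `η L² / 2`, with `L` the gradient error (`noise_error_le`). A geometric sum concludes.

Neither `gap` nor `gradSupDist` is known to be measurable in the noise, so their integrals are lower
integrals and are handled through measurable minorants. -/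

noncomputable section

namespace WPPG

open Filter Topology

variable {d : ℕ}

/-! ### Couplings and the squared Wasserstein distance. -/

section Transport

lemma W2sq_le_of_coupling {μ ν : Measure (Act d)} (Γ : Measure (Act d × Act d))
    (h₁ : Γ.map Prod.fst = μ) (h₂ : Γ.map Prod.snd = ν) :
    W2sq μ ν ≤ ∫⁻ z, edist z.1 z.2 ^ 2 ∂Γ :=
  iInf₂_le Γ ⟨h₁, h₂⟩

lemma measurable_edist_sq :
    Measurable fun z : Act d × Act d => edist z.1 z.2 ^ 2 :=
  (measurable_fst.edist measurable_snd).pow_const 2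

lemma W2sq_swap_le (μ ν : Measure (Act d)) : W2sq ν μ ≤ W2sq μ ν := by
  refine le_iInf₂ fun Γ hΓ => ?_
  refine (W2sq_le_of_coupling (Γ.map Prod.swap) ?_ ?_).trans_eq ?_
  · rw [Measure.map_map measurable_fst measurable_swap]; exact hΓ.2
  · rw [Measure.map_map measurable_snd measurable_swap]; exact hΓ.1
  · rw [lintegral_map measurable_edist_sq measurable_swap]
    simp [edist_comm]

lemma W2sq_comm (μ ν : Measure (Act d)) : W2sq μ ν = W2sq ν μ :=
  le_antisymm (W2sq_swap_le ν μ) (W2sq_swap_le μ ν)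

lemma W2sq_self (μ : Measure (Act d)) : W2sq μ μ = 0 := by
  have hm : Measurable fun x : Act d => (x, x) := measurable_id.prodMk measurable_id
  refine le_antisymm ((W2sq_le_of_coupling (μ.map fun x => (x, x)) ?_ ?_).trans_eq ?_) zero_le
  · rw [Measure.map_map measurable_fst hm]; exact Measure.map_id
  · rw [Measure.map_map measurable_snd hm]; exact Measure.map_id
  · rw [lintegral_map measurable_edist_sq hm]; simp

lemma W2sq_le_of_bounded {A : Set (Act d)} (hA : Bornology.IsBounded A)
    {μ ν : Measure (Act d)} [IsProbabilityMeasure μ] [IsProbabilityMeasure ν]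
    (hμ : μ Aᶜ = 0) (hν : ν Aᶜ = 0) :
    W2sq μ ν ≤ ENNReal.ofReal (Metric.diam A ^ 2) := by
  refine (W2sq_le_of_coupling (μ.prod ν) (by simp) (by simp)).trans ?_
  have h1 : ∀ᵐ z ∂(μ.prod ν), z.1 ∈ A := by
    have : ∀ᵐ x ∂μ, x ∈ A := hμ
    exact Measure.quasiMeasurePreserving_fst.ae this
  have h2 : ∀ᵐ z ∂(μ.prod ν), z.2 ∈ A := by
    have : ∀ᵐ x ∂ν, x ∈ A := hν
    exact Measure.quasiMeasurePreserving_snd.ae this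
  calc ∫⁻ z, edist z.1 z.2 ^ 2 ∂(μ.prod ν)
      ≤ ∫⁻ _, ENNReal.ofReal (Metric.diam A ^ 2) ∂(μ.prod ν) := by
        refine lintegral_mono_ae ?_
        filter_upwards [h1, h2] with z hz1 hz2
        rw [edist_dist, ← ENNReal.ofReal_pow dist_nonneg]
        exact ENNReal.ofReal_le_ofReal
          (pow_le_pow_left₀ dist_nonneg (Metric.dist_le_diam_of_mem hA hz1 hz2) 2)
    _ = _ := by simp

/-- Mixing two couplings with the same second marginal couples the mixture to it. Nonzero finite
weights can be moved inside the infima, even when there is no coupling at all. -/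
lemma W2sq_mixture_le {μ₁ μ₂ ν : Measure (Act d)} {a b : ℝ≥0∞} (ha₀ : a ≠ 0) (hb₀ : b ≠ 0)
    (hab : a + b = 1) :
    W2sq (a • μ₁ + b • μ₂) ν ≤ a * W2sq μ₁ ν + b * W2sq μ₂ ν := by
  have ha : a ≠ ∞ := fun h => by simp [h] at hab
  have hb : b ≠ ∞ := fun h => by simp [h] at hab
  have key : ∀ Γ₁ Γ₂ : Measure (Act d × Act d),
      Γ₁.map Prod.fst = μ₁ ∧ Γ₁.map Prod.snd = ν → Γ₂.map Prod.fst = μ₂ ∧ Γ₂.map Prod.snd = ν →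
      W2sq (a • μ₁ + b • μ₂) ν
        ≤ a * ∫⁻ z, edist z.1 z.2 ^ 2 ∂Γ₁ + b * ∫⁻ z, edist z.1 z.2 ^ 2 ∂Γ₂ := by
    intro Γ₁ Γ₂ h1 h2
    refine (W2sq_le_of_coupling (a • Γ₁ + b • Γ₂) ?_ ?_).trans_eq ?_
    · rw [Measure.map_add _ _ measurable_fst, Measure.map_smul, Measure.map_smul, h1.1, h2.1]
    · rw [Measure.map_add _ _ measurable_snd, Measure.map_smul, Measure.map_smul, h1.2, h2.2,
        ← add_smul, hab, one_smul]
    · simp [lintegral_add_measure, lintegral_smul_measure]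
  rw [W2sq.eq_def μ₁, W2sq.eq_def μ₂]
  simp_rw [ENNReal.mul_iInf_of_ne ha₀ ha, ENNReal.mul_iInf_of_ne hb₀ hb, ENNReal.iInf_add,
    ENNReal.add_iInf]
  exact le_iInf₂ fun Γ₁ h₁ => le_iInf₂ fun Γ₂ h₂ => key Γ₁ Γ₂ h₁ h₂

/-- Kantorovich-type bound with the Young inequality built in: for an `L`-Lipschitz `g`, the
difference of the expectations, penalized by the squared distance, is at most `η L² / 2`. -/
lemma integral_sub_le_W2sq {A : Set (Act d)}
    {μ ν : Measure (Act d)} [IsProbabilityMeasure μ] [IsProbabilityMeasure ν]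
    (hμ : μ Aᶜ = 0) (hν : ν Aᶜ = 0) {g : Act d → ℝ} {L η : ℝ} (hη : 0 < η)
    (hgμ : Integrable g μ) (hgν : Integrable g ν)
    (hg : ∀ x ∈ A, ∀ y ∈ A, |g x - g y| ≤ L * dist x y) (hW : W2sq μ ν ≠ ∞) :
    ∫ a, g a ∂μ - ∫ a, g a ∂ν - 1 / (2 * η) * (W2sq μ ν).toReal ≤ η * L ^ 2 / 2 := by
  -- The claim solved for the distance: `W₂² ≥ X`, which can be checked coupling by coupling.
  set X : ℝ := 2 * η * (∫ a, g a ∂μ - ∫ a, g a ∂ν - η * L ^ 2 / 2) with hX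
  suffices h : ENNReal.ofReal X ≤ W2sq μ ν by
    have h2 : X ≤ (W2sq μ ν).toReal := (ENNReal.ofReal_le_iff_le_toReal hW).1 h
    have h3 : 1 / (2 * η) * X ≤ 1 / (2 * η) * (W2sq μ ν).toReal :=
      mul_le_mul_of_nonneg_left h2 (by positivity)
    have h4 : 1 / (2 * η) * X = ∫ a, g a ∂μ - ∫ a, g a ∂ν - η * L ^ 2 / 2 := by
      rw [hX]; field_simp
    linarith
  refine le_iInf₂ fun Γ hΓ => ?_
  obtain ⟨h₁, h₂⟩ := hΓ
  have hΓp : IsProbabilityMeasure Γ := by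
    refine ⟨?_⟩
    rw [← preimage_univ (f := Prod.fst), ← Measure.map_apply measurable_fst .univ, h₁,
      measure_univ]
  by_cases hfin : ∫⁻ z, edist z.1 z.2 ^ 2 ∂Γ = ∞
  · rw [hfin]; exact le_top
  have hint : Integrable (fun z : Act d × Act d => dist z.1 z.2 ^ 2) Γ := by
    refine ⟨((measurable_fst.dist measurable_snd).pow_const 2).aestronglyMeasurable, ?_⟩
    rw [hasFiniteIntegral_iff_ofReal (.of_forall fun z => by positivity)]
    simpa [edist_dist, ENNReal.ofReal_pow] using lt_top_iff_ne_top.2 hfin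
  have e : ∫⁻ z, edist z.1 z.2 ^ 2 ∂Γ = ENNReal.ofReal (∫ z, dist z.1 z.2 ^ 2 ∂Γ) := by
    rw [ofReal_integral_eq_lintegral_ofReal hint (.of_forall fun z => by positivity)]
    simp [edist_dist, ENNReal.ofReal_pow]
  rw [e]
  refine ENNReal.ofReal_le_ofReal ?_
  have hm₁ : MeasurePreserving Prod.fst Γ μ := ⟨measurable_fst, h₁⟩
  have hm₂ : MeasurePreserving Prod.snd Γ ν := ⟨measurable_snd, h₂⟩
  have hA₁ : ∀ᵐ z ∂Γ, z.1 ∈ A := hm₁.quasiMeasurePreserving.ae (show ∀ᵐ x ∂μ, x ∈ A from hμ)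
  have hA₂ : ∀ᵐ z ∂Γ, z.2 ∈ A := hm₂.quasiMeasurePreserving.ae (show ∀ᵐ x ∂ν, x ∈ A from hν)
  have i₁ : Integrable (fun z : Act d × Act d => g z.1) Γ := hm₁.integrable_comp_of_integrable hgμ
  have i₂ : Integrable (fun z : Act d × Act d => g z.2) Γ := hm₂.integrable_comp_of_integrable hgν
  have e₁ : ∫ a, g a ∂μ = ∫ z, g z.1 ∂Γ := by
    rw [← h₁] at hgμ ⊢
    exact integral_map measurable_fst.aemeasurable hgμ.aestronglyMeasurable
  have e₂ : ∫ a, g a ∂ν = ∫ z, g z.2 ∂Γ := by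
    rw [← h₂] at hgν ⊢
    exact integral_map measurable_snd.aemeasurable hgν.aestronglyMeasurable
  rw [hX, e₁, e₂]
  have e₃ : 2 * η * (∫ z, g z.1 ∂Γ - ∫ z, g z.2 ∂Γ - η * L ^ 2 / 2)
      = ∫ z, 2 * η * (g z.1 - g z.2 - η * L ^ 2 / 2) ∂Γ := by
    have h1 := integral_sub (i₁.sub i₂) (integrable_const (η * L ^ 2 / 2))
    have h2 := integral_sub i₁ i₂
    simp only [Pi.sub_apply, integral_const, probReal_univ, one_smul] at h1
    rw [integral_const_mul, h1, h2]
  rw [e₃]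
  refine integral_mono_ae (((i₁.sub i₂).sub (integrable_const _)).const_mul _) hint ?_
  filter_upwards [hA₁, hA₂] with z hz₁ hz₂
  have h5 := (abs_le.1 (hg _ hz₁ _ hz₂)).2
  have h6 : 2 * η * (g z.1 - g z.2) ≤ 2 * η * (L * dist z.1 z.2) :=
    mul_le_mul_of_nonneg_left h5 (by positivity)
  -- Young's inequality `2 η L d ≤ d² + η² L²`.
  nlinarith [sq_nonneg (dist z.1 z.2 - η * L)]

/-- On a convex set the Lipschitz constant of `f s - g s` is controlled by `gradSupDist`. -/
lemma abs_sub_le_gradSupDist {S : Type*} {A : Set (Act d)} (hA : Convex ℝ A)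
    {f g : S → Act d → ℝ} (hL : gradSupDist A f g ≠ ∞) (s : S)
    (hf : DifferentiableOn ℝ (f s) A) (hg : DifferentiableOn ℝ (g s) A)
    {x y : Act d} (hx : x ∈ A) (hy : y ∈ A) :
    |(f s x - g s x) - (f s y - g s y)| ≤ (gradSupDist A f g).toReal * dist x y := by
  rw [dist_eq_norm, ← Real.norm_eq_abs]
  refine hA.norm_image_sub_le_of_norm_hasFDerivWithin_le (f := fun z => f s z - g s z)
    (f' := fun z => fderivWithin ℝ (f s) A z - fderivWithin ℝ (g s) A z)
    (fun z hz => (hf z hz).hasFDerivWithinAt.sub (hg z hz).hasFDerivWithinAt) (fun z hz => ?_)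
    hy hx
  have h1 : ‖gradientWithin (f s) A z - gradientWithin (g s) A z‖ₑ ≤ gradSupDist A f g :=
    le_iSup_of_le s (le_iSup₂_of_le z hz le_rfl)
  have h2 : ‖fderivWithin ℝ (f s) A z - fderivWithin ℝ (g s) A z‖
      = ‖gradientWithin (f s) A z - gradientWithin (g s) A z‖ := by
    rw [gradientWithin, gradientWithin, ← map_sub, LinearIsometryEquiv.norm_map]
  rw [h2, ← toReal_enorm]
  exact ENNReal.toReal_mono hL h1

end Transport

/-! ### Entropy along mixtures, Kullback-Leibler divergence and the growth of the proximal
objective. -/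

section Entropy

/-- Density of `q` with respect to the Lebesgue measure, as a real function. -/
def density (q : Measure (Act d)) (a : Act d) : ℝ := (q.rnDeriv volume a).toReal

lemma density_nonneg (q : Measure (Act d)) (a : Act d) : 0 ≤ density q a := ENNReal.toReal_nonneg

lemma measurable_density (q : Measure (Act d)) : Measurable (density q) :=
  (Measure.measurable_rnDeriv _ _).ennreal_toReal

variable {A : Set (Act d)} {q : Measure (Act d)}

lemma IsActionLaw.ae_mem (hq : IsActionLaw A q) : ∀ᵐ a ∂q, a ∈ A := hq.supported

lemma IsActionLaw.negEntropy_eq (hq : IsActionLaw A q) :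
    negEntropy q = ∫ a, density q a * Real.log (density q a) := by
  have := hq.isProb
  exact (integral_rnDeriv_smul hq.hasDensity (f := logDensity q)).symm

lemma IsActionLaw.integrable_mul_log (hq : IsActionLaw A q) :
    Integrable (fun a => density q a * Real.log (density q a)) := by
  have := hq.isProb
  exact (integrable_rnDeriv_smul_iff hq.hasDensity (f := logDensity q)).2 hq.finiteEntropy

lemma IsActionLaw.density_eq_zero (hA : MeasurableSet A) (hq : IsActionLaw A q) :
    ∀ᵐ a, a ∉ A → density q a = 0 := by
  have := hq.isProb
  have h : ∫⁻ a in Aᶜ, q.rnDeriv volume a = 0 := by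
    rw [Measure.setLIntegral_rnDeriv hq.hasDensity, hq.supported]
  rw [lintegral_eq_zero_iff (Measure.measurable_rnDeriv _ _)] at h
  filter_upwards [(ae_restrict_iff' hA.compl).1 h] with a ha haA
  simp [density, show q.rnDeriv volume a = 0 from ha haA]

lemma neg_one_le_mul_log {x : ℝ} (hx : 0 ≤ x) : -1 ≤ x * Real.log x := by
  linarith [Real.self_sub_one_le_mul_log hx]

lemma volume_ne_top_of_bounded (hA : Bornology.IsBounded A) : volume A ≠ ∞ :=
  hA.measure_lt_top.ne

/-- Since `x log x ≥ -1`, and the density vanishes off `A`, finite volume bounds the entropy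
functional from below. -/
lemma IsActionLaw.neg_volume_le_negEntropy (hAm : MeasurableSet A) (hA : Bornology.IsBounded A)
    (hq : IsActionLaw A q) : -(volume A).toReal ≤ negEntropy q := by
  have hi : Integrable (A.indicator fun _ => (-1 : ℝ)) (volume : Measure (Act d)) :=
    (integrable_indicator_iff hAm).2 (integrableOn_const (volume_ne_top_of_bounded hA))
  have h : ∫ a, A.indicator (fun _ => (-1 : ℝ)) a = -(volume A).toReal := by
    rw [integral_indicator hAm]; simp [Measure.real]
  rw [hq.negEntropy_eq, ← h]
  refine integral_mono_ae hi hq.integrable_mul_log ?_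
  filter_upwards [hq.density_eq_zero hAm] with a ha
  by_cases haA : a ∈ A
  · simpa [haA] using neg_one_le_mul_log (density_nonneg q a)
  · simp [haA, ha haA]

/-- The pointwise integrand `x log (x / y) - x + y` of the Kullback-Leibler divergence. -/
def klPoint (x y : ℝ) : ℝ := x * Real.log x - x * Real.log y - x + y

lemma klPoint_eq {x y : ℝ} (hx : 0 ≤ x) (hy : 0 < y) :
    klPoint x y = y * InformationTheory.klFun (x / y) := by
  rw [klPoint, InformationTheory.klFun_apply]
  rcases hx.eq_or_lt with rfl | hx
  · simp
  · rw [Real.log_div hx.ne' hy.ne']; field_simp; ring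

lemma klPoint_nonneg {x y : ℝ} (hx : 0 ≤ x) (hy : 0 < y) : 0 ≤ klPoint x y := by
  rw [klPoint_eq hx hy]
  exact mul_nonneg hy.le (InformationTheory.klFun_nonneg (div_nonneg hx hy.le))

/-- With `m` the mixture of `y` and `x`, the right side minus the left is exactly `(1 - t) klPoint y
m`, which is nonnegative. -/
lemma mul_klPoint_mix_le {x y t : ℝ} (hx : 0 ≤ x) (hy : 0 ≤ y) (ht₀ : 0 < t) (ht₁ : t < 1) :
    t * klPoint x ((1 - t) * y + t * x)
      ≤ (1 - t) * (y * Real.log y) + t * (x * Real.log x)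
        - ((1 - t) * y + t * x) * Real.log ((1 - t) * y + t * x) := by
  have h1 : 0 ≤ (1 - t) * y := mul_nonneg (by linarith) hy
  have h2 : 0 ≤ t * x := mul_nonneg ht₀.le hx
  rcases (add_nonneg h1 h2).eq_or_lt with hm | hm
  · have hx0 : x = 0 := by
      have : t * x = 0 := by linarith
      rcases mul_eq_zero.1 this with h | h
      · exact absurd h ht₀.ne'
      · exact h
    have hy0 : y = 0 := by
      have : (1 - t) * y = 0 := by linarith
      rcases mul_eq_zero.1 this with h | h
      · linarith
      · exact h
    simp [hx0, hy0, klPoint]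
  · have h3 := mul_nonneg (show 0 ≤ 1 - t by linarith) (klPoint_nonneg hy hm)
    simp only [klPoint] at h3 ⊢
    nlinarith

lemma measurable_klPoint {α : Type*} [MeasurableSpace α] {f g : α → ℝ} (hf : Measurable f)
    (hg : Measurable g) : Measurable fun a => klPoint (f a) (g a) := by
  unfold klPoint
  exact (((hf.mul hf.log).sub (hf.mul hg.log)).sub hf).add hg

/-- The mixture `(1 - t) r + t q`. -/
def mixture (t : ℝ) (r q : Measure (Act d)) : Measure (Act d) :=
  ENNReal.ofReal (1 - t) • r + ENNReal.ofReal t • q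

variable {r : Measure (Act d)} {t : ℝ}

lemma density_mixture (hr : IsFiniteMeasure r) (hq : IsFiniteMeasure q)
    (ht₀ : 0 < t) (ht₁ : t < 1) :
    density (mixture t r q) =ᵐ[volume] fun a => (1 - t) * density r a + t * density q a := by
  have : IsFiniteMeasure (ENNReal.ofReal (1 - t) • r) := Measure.smul_finite r ENNReal.ofReal_ne_top
  have : IsFiniteMeasure (ENNReal.ofReal t • q) := Measure.smul_finite q ENNReal.ofReal_ne_top
  have h1 := Measure.rnDeriv_add (ENNReal.ofReal (1 - t) • r) (ENNReal.ofReal t • q)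
    (volume : Measure (Act d))
  have h2 := Measure.rnDeriv_smul_left_of_ne_top r (volume : Measure (Act d))
    (r := ENNReal.ofReal (1 - t)) ENNReal.ofReal_ne_top
  have h3 := Measure.rnDeriv_smul_left_of_ne_top q (volume : Measure (Act d))
    (r := ENNReal.ofReal t) ENNReal.ofReal_ne_top
  filter_upwards [h1, h2, h3, r.rnDeriv_lt_top volume, q.rnDeriv_lt_top volume]
    with a h1 h2 h3 h4 h5
  simp only [density, mixture]
  rw [h1, Pi.add_apply, h2, h3, Pi.smul_apply, Pi.smul_apply, smul_eq_mul, smul_eq_mul,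
    ENNReal.toReal_add (ENNReal.mul_ne_top ENNReal.ofReal_ne_top h4.ne)
      (ENNReal.mul_ne_top ENNReal.ofReal_ne_top h5.ne), ENNReal.toReal_mul, ENNReal.toReal_mul,
    ENNReal.toReal_ofReal (by linarith), ENNReal.toReal_ofReal ht₀.le]

/-- The integrand is squeezed between `-1` and the convex combination of the two entropy integrands
on `A`, and vanishes off `A`. -/
lemma IsActionLaw.integrable_mixture_mul_log (hAm : MeasurableSet A) (hA : Bornology.IsBounded A)
    (hr : IsActionLaw A r) (hq : IsActionLaw A q) (ht₀ : 0 < t) (ht₁ : t < 1) :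
    Integrable fun a => ((1 - t) * density r a + t * density q a)
      * Real.log ((1 - t) * density r a + t * density q a) := by
  have hi : Integrable (A.indicator fun _ => (1 : ℝ)) (volume : Measure (Act d)) :=
    (integrable_indicator_iff hAm).2 (integrableOn_const (volume_ne_top_of_bounded hA))
  have hc := (hr.integrable_mul_log.const_mul (1 - t)).add (hq.integrable_mul_log.const_mul t)
  have hm : Measurable fun a => (1 - t) * density r a + t * density q a :=
    ((measurable_density r).const_mul _).add ((measurable_density q).const_mul _)
  refine (hc.abs.add hi).mono' (hm.mul hm.log).aestronglyMeasurable ?_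
  filter_upwards [hr.density_eq_zero hAm, hq.density_eq_zero hAm] with a hra hqa
  by_cases haA : a ∈ A
  · have h1 := Real.convexOn_mul_log.2 (density_nonneg r a) (density_nonneg q a)
      (show 0 ≤ 1 - t by linarith) ht₀.le (by ring)
    have h2 := neg_one_le_mul_log (add_nonneg (mul_nonneg (show 0 ≤ 1 - t by linarith)
      (density_nonneg r a)) (mul_nonneg ht₀.le (density_nonneg q a)))
    simp only [smul_eq_mul] at h1
    simp only [Pi.add_apply, indicator_of_mem haA, Real.norm_eq_abs]
    refine abs_le.2 ⟨?_, ?_⟩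
    · linarith [abs_nonneg ((1 - t) * (density r a * Real.log (density r a))
        + t * (density q a * Real.log (density q a)))]
    · linarith [le_abs_self ((1 - t) * (density r a * Real.log (density r a))
        + t * (density q a * Real.log (density q a)))]
  · simp [haA, hra haA, hqa haA]

lemma IsActionLaw.mixture (hAm : MeasurableSet A) (hA : Bornology.IsBounded A)
    (hr : IsActionLaw A r) (hq : IsActionLaw A q) (ht₀ : 0 < t) (ht₁ : t < 1) :
    IsActionLaw A (mixture t r q) := by
  have := hr.isProb
  have := hq.isProb
  have hp : IsProbabilityMeasure (WPPG.mixture t r q) := by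
    refine ⟨?_⟩
    simp only [WPPG.mixture, Measure.add_apply, Measure.smul_apply, measure_univ, smul_eq_mul,
      mul_one]
    rw [← ENNReal.ofReal_add (by linarith) ht₀.le]; simp
  have hac : WPPG.mixture t r q ≪ volume := by
    refine Measure.AbsolutelyContinuous.add_left ?_ ?_
    · exact hr.hasDensity.smul_left _
    · exact hq.hasDensity.smul_left _
  refine ⟨hp, ?_, hac, ?_⟩
  · simp [WPPG.mixture, hr.supported, hq.supported]
  · refine (integrable_rnDeriv_smul_iff hac (f := logDensity (WPPG.mixture t r q))).1 ?_
    refine (hr.integrable_mixture_mul_log hAm hA hq ht₀ ht₁).congr ?_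
    filter_upwards [density_mixture (t := t) (r := r) (q := q) inferInstance inferInstance
      ht₀ ht₁] with a ha
    rw [← ha]; rfl

lemma IsActionLaw.lintegral_klPoint_mixture_le (hAm : MeasurableSet A)
    (hA : Bornology.IsBounded A) (hr : IsActionLaw A r) (hq : IsActionLaw A q)
    (ht₀ : 0 < t) (ht₁ : t < 1) :
    ∫⁻ a, ENNReal.ofReal (klPoint (density q a) ((1 - t) * density r a + t * density q a))
      ≤ ENNReal.ofReal (((1 - t) * negEntropy r + t * negEntropy q
          - negEntropy (WPPG.mixture t r q)) / t) := by
  have := hr.isProb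
  have := hq.isProb
  have hi := hr.integrable_mixture_mul_log hAm hA hq ht₀ ht₁
  have e : negEntropy (WPPG.mixture t r q) = ∫ a, ((1 - t) * density r a + t * density q a)
      * Real.log ((1 - t) * density r a + t * density q a) := by
    rw [(hr.mixture hAm hA hq ht₀ ht₁).negEntropy_eq]
    refine integral_congr_ae ?_
    filter_upwards [density_mixture (t := t) (r := r) (q := q) inferInstance inferInstance
      ht₀ ht₁] with a ha
    rw [ha]
  have ir := hr.integrable_mul_log.const_mul (1 - t)
  have iq := hq.integrable_mul_log.const_mul t
  have hI : Integrable fun a => ((1 - t) * (density r a * Real.log (density r a))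
      + t * (density q a * Real.log (density q a))
      - ((1 - t) * density r a + t * density q a)
        * Real.log ((1 - t) * density r a + t * density q a)) / t :=
    ((ir.add iq).sub hi).div_const t
  have e2 : ((1 - t) * negEntropy r + t * negEntropy q
          - negEntropy (WPPG.mixture t r q)) / t
      = ∫ a, ((1 - t) * (density r a * Real.log (density r a))
      + t * (density q a * Real.log (density q a))
      - ((1 - t) * density r a + t * density q a)
        * Real.log ((1 - t) * density r a + t * density q a)) / t := by
    have h1 := integral_sub (ir.add iq) hi
    have h2 := integral_add ir iq
    simp only [Pi.add_apply] at h1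
    rw [integral_div, h1, h2, integral_const_mul,
      integral_const_mul, e, hr.negEntropy_eq, hq.negEntropy_eq]
  rw [e2]
  have hle : ∀ a, klPoint (density q a) ((1 - t) * density r a + t * density q a)
      ≤ ((1 - t) * (density r a * Real.log (density r a))
      + t * (density q a * Real.log (density q a))
      - ((1 - t) * density r a + t * density q a)
        * Real.log ((1 - t) * density r a + t * density q a)) / t := by
    intro a
    rw [le_div_iff₀ ht₀, mul_comm]
    exact mul_klPoint_mix_le (density_nonneg _ _) (density_nonneg _ _) ht₀ ht₁
  refine (lintegral_mono fun a => ENNReal.ofReal_le_ofReal (hle a)).trans ?_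
  rw [ofReal_integral_eq_lintegral_ofReal hI]
  refine .of_forall fun a => ?_
  have h1 := Real.convexOn_mul_log.2 (density_nonneg r a) (density_nonneg q a)
    (show 0 ≤ 1 - t by linarith) ht₀.le (by ring)
  simp only [smul_eq_mul] at h1
  exact div_nonneg (by linarith) ht₀.le

/-- The support hypothesis gives `q ≪ r`; the chain rule for densities then moves the integral from
`r` to Lebesgue measure. -/
lemma IsActionLaw.klDiv_eq (hr : IsActionLaw A r) (hq : IsActionLaw A q)
    (h : ∀ᵐ a, density r a = 0 → density q a = 0) :
    InformationTheory.klDiv q r = ∫⁻ a, ENNReal.ofReal (klPoint (density q a) (density r a)) := by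
  have := hr.isProb
  have := hq.isProb
  have hac : q ≪ r := by
    refine Measure.AbsolutelyContinuous.mk fun s hs hrs => ?_
    rw [← Measure.setLIntegral_rnDeriv hr.hasDensity,
      lintegral_eq_zero_iff (Measure.measurable_rnDeriv _ _)] at hrs
    rw [← Measure.setLIntegral_rnDeriv hq.hasDensity,
      lintegral_eq_zero_iff (Measure.measurable_rnDeriv _ _)]
    filter_upwards [hrs, ae_restrict_of_ae h, ae_restrict_of_ae (q.rnDeriv_lt_top volume)]
      with a h1 h2 h3
    have h4 : density q a = 0 := h2 (by simp [density, show r.rnDeriv volume a = 0 from h1])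
    exact ((ENNReal.toReal_eq_zero_iff _).1 h4).resolve_right h3.ne
  rw [InformationTheory.klDiv_eq_lintegral_klFun_of_ac hac,
    ← lintegral_rnDeriv_mul hr.hasDensity
      (f := fun a => ENNReal.ofReal (InformationTheory.klFun (q.rnDeriv r a).toReal))
      (InformationTheory.measurable_klFun.comp
        (Measure.measurable_rnDeriv q r).ennreal_toReal).ennreal_ofReal.aemeasurable]
  refine lintegral_congr_ae ?_
  filter_upwards [Measure.rnDeriv_mul_rnDeriv (κ := volume) hac, h, r.rnDeriv_lt_top volume]
    with a h1 h2 h3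
  have h4 : density q a = (q.rnDeriv r a).toReal * density r a := by
    rw [density, density, ← h1, Pi.mul_apply, ENNReal.toReal_mul]
  rcases (density_nonneg r a).eq_or_lt with h0 | h0
  · have h5 : r.rnDeriv volume a = 0 :=
      ((ENNReal.toReal_eq_zero_iff _).1 h0.symm).resolve_right h3.ne
    rw [h5, h2 h0.symm, ← h0]; simp [klPoint]
  · rw [klPoint_eq (density_nonneg _ _) h0, h4, mul_div_assoc, div_self h0.ne', mul_one,
      ENNReal.ofReal_mul h0.le, density, ENNReal.ofReal_toReal h3.ne]

/-- Lower semicontinuity of `y ↦ klPoint x y` along the segment from `y` to `x`, with value `∞`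
where the second density vanishes and the first does not. -/
lemma klPoint_le_liminf {x y : ℝ} (hx : 0 ≤ x) (hy : 0 ≤ y) {u : ℕ → ℝ}
    (hu₀ : ∀ n, 0 < u n) (hu : Tendsto u atTop (𝓝 0)) :
    (if y = 0 ∧ x ≠ 0 then ∞ else ENNReal.ofReal (klPoint x y))
      ≤ liminf (fun n => ENNReal.ofReal (klPoint x ((1 - u n) * y + u n * x))) atTop := by
  have hm : Tendsto (fun n => (1 - u n) * y + u n * x) atTop (𝓝 y) := by
    have := ((tendsto_const_nhds (x := (1 : ℝ))).sub hu).mul_const y |>.add (hu.mul_const x)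
    simpa using this
  split_ifs with h
  · obtain ⟨rfl, hx0⟩ := h
    have hxp : 0 < x := lt_of_le_of_ne hx (Ne.symm hx0)
    refine le_of_eq (Tendsto.liminf_eq ?_).symm
    refine ENNReal.tendsto_ofReal_nhds_top.2 ?_
    have hlog : Tendsto (fun n => Real.log ((1 - u n) * 0 + u n * x)) atTop atBot := by
      refine Real.tendsto_log_nhdsGT_zero.comp (tendsto_nhdsWithin_iff.2 ⟨hm, .of_forall fun n => ?_⟩)
      simpa using mul_pos (hu₀ n) hxp
    have h1 : Tendsto (fun n => x * Real.log x + -x * Real.log ((1 - u n) * 0 + u n * x))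
        atTop atTop :=
      tendsto_atTop_add_const_left _ _ (hlog.const_mul_atBot_of_neg (by linarith))
    have h2 := (h1.atTop_add (tendsto_const_nhds (x := -x))).atTop_add hm
    refine h2.congr fun n => ?_
    simp only [klPoint]; ring
  · refine le_of_eq (Tendsto.liminf_eq (ENNReal.tendsto_ofReal ?_)).symm
    simp only [klPoint]
    refine (tendsto_const_nhds.sub ?_ |>.sub tendsto_const_nhds).add hm
    by_cases hx0 : x = 0
    · simp [hx0]
    · have hy0 : y ≠ 0 := fun h0 => h ⟨h0, hx0⟩
      exact (hm.log hy0).const_mul x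

/-- The hypothesis bounds the divergence of `q` from each mixture by `c`; Fatou's lemma passes to `t
→ 0`. Absolute continuity `q ≪ r` is not assumed but obtained: the limit integrand is `∞` where it
would fail, and its integral is finite. -/
lemma IsActionLaw.klDiv_le_of_mixture (hAm : MeasurableSet A) (hA : Bornology.IsBounded A)
    (hr : IsActionLaw A r) (hq : IsActionLaw A q) {c : ℝ}
    (h : ∀ t : ℝ, 0 < t → t < 1 →
      (1 - t) * negEntropy r + t * negEntropy q - negEntropy (WPPG.mixture t r q) ≤ t * c) :
    InformationTheory.klDiv q r ≤ ENNReal.ofReal c := by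
  set u : ℕ → ℝ := fun n => 1 / ((n : ℝ) + 2) with hu
  have hu₀ : ∀ n, 0 < u n := fun n => by positivity
  have hu₁ : ∀ n, u n < 1 := fun n => by
    rw [hu]; simp only; rw [div_lt_one (by positivity)]
    have : (0 : ℝ) ≤ n := n.cast_nonneg
    linarith
  have hu' : Tendsto u atTop (𝓝 0) := by
    refine tendsto_const_nhds.div_atTop ?_
    exact tendsto_atTop_add_const_right _ _ tendsto_natCast_atTop_atTop
  set Φ : Act d → ℝ≥0∞ := fun a => if density r a = 0 ∧ density q a ≠ 0 then ∞
    else ENNReal.ofReal (klPoint (density q a) (density r a)) with hΦ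
  have hΦm : Measurable Φ := by
    refine Measurable.ite ?_ measurable_const
      (measurable_klPoint (measurable_density q) (measurable_density r)).ennreal_ofReal
    exact (measurable_density r (measurableSet_singleton 0)).inter
      (measurable_density q (measurableSet_singleton 0)).compl
  have hle : ∫⁻ a, Φ a ≤ ENNReal.ofReal c := by
    calc ∫⁻ a, Φ a ≤ ∫⁻ a, liminf (fun n => ENNReal.ofReal (klPoint (density q a)
          ((1 - u n) * density r a + u n * density q a))) atTop :=
          lintegral_mono fun a =>
            klPoint_le_liminf (density_nonneg q a) (density_nonneg r a) hu₀ hu'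
      _ ≤ liminf (fun n => ∫⁻ a, ENNReal.ofReal (klPoint (density q a)
          ((1 - u n) * density r a + u n * density q a))) atTop :=
          lintegral_liminf_le fun n => (measurable_klPoint (measurable_density q)
            (((measurable_density r).const_mul _).add
              ((measurable_density q).const_mul _))).ennreal_ofReal
      _ ≤ liminf (fun _ : ℕ => ENNReal.ofReal c) atTop := by
          refine liminf_le_liminf (.of_forall fun n => ?_)
          refine (hr.lintegral_klPoint_mixture_le hAm hA hq (hu₀ n) (hu₁ n)).trans
            (ENNReal.ofReal_le_ofReal ?_)
          rw [div_le_iff₀ (hu₀ n), mul_comm c]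
          exact h _ (hu₀ n) (hu₁ n)
      _ = ENNReal.ofReal c := liminf_const _
  have hfin : ∀ᵐ a, Φ a < ∞ := ae_lt_top hΦm (hle.trans_lt ENNReal.ofReal_lt_top).ne
  have hz : ∀ᵐ a, density r a = 0 → density q a = 0 := by
    filter_upwards [hfin] with a ha h0
    by_contra h1
    simp [hΦ, h0, h1] at ha
  rw [hr.klDiv_eq hq hz]
  refine le_of_eq_of_le (lintegral_congr_ae ?_) hle
  filter_upwards [hz] with a ha
  simp only [hΦ]
  rw [if_neg]
  exact fun h => h.2 (ha h.1)

lemma IsActionLaw.isP2 (hA : Bornology.IsBounded A) (hq : IsActionLaw A q) : IsP2 q := by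
  have := hq.isProb
  refine ⟨this, ?_⟩
  obtain ⟨R, hR⟩ := hA.exists_norm_le
  calc ∫⁻ x, ‖x‖ₑ ^ 2 ∂q ≤ ∫⁻ _, ENNReal.ofReal R ^ 2 ∂q := by
        refine lintegral_mono_ae ?_
        filter_upwards [hq.ae_mem] with x hx
        gcongr
        rw [← ofReal_norm]
        exact ENNReal.ofReal_le_ofReal (hR x hx)
    _ < ∞ := by simp

lemma IsActionLaw.W2sq_ne_top (hA : Bornology.IsBounded A) (hr : IsActionLaw A r)
    (hq : IsActionLaw A q) : W2sq r q ≠ ∞ := by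
  have := hr.isProb
  have := hq.isProb
  exact ((W2sq_le_of_bounded hA hr.supported hq.supported).trans_lt ENNReal.ofReal_lt_top).ne

lemma IsActionLaw.integrable_of_bounded (hq : IsActionLaw A q) {f : Act d → ℝ} {B : ℝ}
    (hf : AEStronglyMeasurable f q) (hB : ∀ a ∈ A, |f a| ≤ B) : Integrable f q := by
  have := hq.isProb
  exact Integrable.of_bound hf B (hq.ae_mem.mono hB)

lemma IsActionLaw.abs_integral_le (hq : IsActionLaw A q) {f : Act d → ℝ} {B : ℝ}
    (hB : ∀ a ∈ A, |f a| ≤ B) : |∫ a, f a ∂q| ≤ B := by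
  have := hq.isProb
  simpa using norm_integral_le_of_norm_le_const (f := f) (C := B) (hq.ae_mem.mono hB)

/-- Growth of the proximal objective away from its maximizer, with the modulus given by the
transport inequality at the maximizer. -/
lemma IsProxStep.add_W2sq_le (hAm : MeasurableSet A) (hA : Bornology.IsBounded A)
    {τ η lam B : ℝ} (hτ : 0 < τ) (hη : 0 < η) (hlam : 0 < lam) {f : Act d → ℝ}
    (hf : Measurable f) (hB : ∀ a ∈ A, |f a| ≤ B) {μ : Measure (Act d)} (hμ : IsActionLaw A μ)
    (hr : IsProxStep A τ η f μ r) (hT : SatisfiesT2 lam r) (hq : IsActionLaw A q) :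
    proxObjective τ η f μ q + lam * τ / 2 * (W2sq q r).toReal ≤ proxObjective τ η f μ r := by
  obtain ⟨hr, hmax⟩ := hr
  have hgap : 0 ≤ proxObjective τ η f μ r - proxObjective τ η f μ q := sub_nonneg.2 (hmax q hq)
  have hkl : InformationTheory.klDiv q r
      ≤ ENNReal.ofReal ((proxObjective τ η f μ r - proxObjective τ η f μ q) / τ) := by
    refine hr.klDiv_le_of_mixture hAm hA hq fun t ht₀ ht₁ => ?_
    have hmx := hr.mixture hAm hA hq ht₀ ht₁
    have h1 := hmax _ hmx
    have hif : ∫ a, f a ∂(WPPG.mixture t r q)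
        = (1 - t) * ∫ a, f a ∂r + t * ∫ a, f a ∂q := by
      have ir := hr.integrable_of_bounded hf.aestronglyMeasurable hB
      have iq := hq.integrable_of_bounded hf.aestronglyMeasurable hB
      rw [WPPG.mixture, integral_add_measure (ir.smul_measure ENNReal.ofReal_ne_top)
        (iq.smul_measure ENNReal.ofReal_ne_top), integral_smul_measure, integral_smul_measure,
        ENNReal.toReal_ofReal (by linarith), ENNReal.toReal_ofReal ht₀.le]
      rfl
    have hW : (W2sq (WPPG.mixture t r q) μ).toReal
        ≤ (1 - t) * (W2sq r μ).toReal + t * (W2sq q μ).toReal := by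
      have hr' := hr.W2sq_ne_top hA hμ
      have hq' := hq.W2sq_ne_top hA hμ
      have h := W2sq_mixture_le (μ₁ := r) (μ₂ := q) (ν := μ) (a := ENNReal.ofReal (1 - t))
        (b := ENNReal.ofReal t) (by simpa using ht₁) (by simpa using ht₀)
        (by rw [← ENNReal.ofReal_add (by linarith) ht₀.le]; simp)
      have h2 := ENNReal.toReal_mono (ENNReal.add_ne_top.2
        ⟨ENNReal.mul_ne_top ENNReal.ofReal_ne_top hr', ENNReal.mul_ne_top ENNReal.ofReal_ne_top hq'⟩) h
      rwa [ENNReal.toReal_add (ENNReal.mul_ne_top ENNReal.ofReal_ne_top hr')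
        (ENNReal.mul_ne_top ENNReal.ofReal_ne_top hq'), ENNReal.toReal_mul, ENNReal.toReal_mul,
        ENNReal.toReal_ofReal (by linarith), ENNReal.toReal_ofReal ht₀.le] at h2
    have hW' := mul_le_mul_of_nonneg_left hW (show 0 ≤ 1 / (2 * η) by positivity)
    -- In the comparison of `r` with the mixture the reward is linear and the transport term convex,
    -- so only `τ` times the entropy defect remains, bounded by `t` times the objective gap.
    rw [mul_div_assoc', le_div_iff₀ hτ]
    simp only [proxObjective, hif] at h1 ⊢
    nlinarith
  have hW : W2sq q r ≤ ENNReal.ofReal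
      (2 / lam * ((proxObjective τ η f μ r - proxObjective τ η f μ q) / τ)) := by
    rw [ENNReal.ofReal_mul (by positivity)]
    exact (hT.2 q (hq.isP2 hA)).trans (by gcongr)
  have h3 := ENNReal.toReal_le_of_le_ofReal (by positivity) hW
  have h4 := mul_le_mul_of_nonneg_left h3 (show 0 ≤ lam * τ / 2 by positivity)
  have h5 : lam * τ / 2 * (2 / lam * ((proxObjective τ η f μ r - proxObjective τ η f μ q) / τ))
      = proxObjective τ η f μ r - proxObjective τ η f μ q := by field_simp
  linarith

end Entropy

/-! ### Measurability of the entropy of a kernel. -/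

section Kernels

variable {S : Type*} [MeasurableSpace S]

lemma integrable_of_measurable_of_abs_le {α : Type*} [MeasurableSpace α] {μ : Measure α}
    [IsFiniteMeasure μ] {f : α → ℝ} {C : ℝ} (hf : Measurable f) (hC : ∀ x, |f x| ≤ C) :
    Integrable f μ :=
  Integrable.of_bound hf.aestronglyMeasurable C (.of_forall hC)

lemma abs_integral_le_of_abs_le {α : Type*} [MeasurableSpace α] {μ : Measure α}
    [IsProbabilityMeasure μ] {f : α → ℝ} {C : ℝ} (hC : ∀ x, |f x| ≤ C) : |∫ x, f x ∂μ| ≤ C := by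
  simpa using norm_integral_le_of_norm_le_const (f := f) (C := C) (μ := μ) (.of_forall hC)

variable {A : Set (Act d)} {π : Kernel S (Act d)}

lemma isMarkovKernel_of_isActionLaw (hπ : ∀ s, IsActionLaw A (π s)) : IsMarkovKernel π :=
  ⟨fun s => (hπ s).isProb⟩

/-- The densities of the individual laws `π s` are chosen separately and need not be jointly
measurable. The kernel Radon-Nikodym derivative is jointly measurable, and agrees with them almost
everywhere. -/
lemma measurable_negEntropy (hAm : MeasurableSet A) (hA : Bornology.IsBounded A)
    (hπ : ∀ s, IsActionLaw A (π s)) : Measurable fun s => negEntropy (π s) := by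
  have := isMarkovKernel_of_isActionLaw hπ
  have : IsFiniteMeasure (volume.restrict A : Measure (Act d)) :=
    ⟨by simpa using hA.measure_lt_top⟩
  set η : Kernel S (Act d) := Kernel.const S (volume.restrict A) with hη
  have hm : StronglyMeasurable fun p : S × Act d =>
      Real.log (Kernel.rnDeriv π η p.1 p.2).toReal :=
    (Kernel.measurable_rnDeriv π η).ennreal_toReal.log.stronglyMeasurable
  have h := hm.integral_kernel_prod_right' (κ := π)
  convert h.measurable using 2 with s
  refine integral_congr_ae ?_
  have hac : π s ≪ volume.restrict A := by
    refine Measure.AbsolutelyContinuous.mk fun t ht h0 => ?_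
    rw [Measure.restrict_apply ht] at h0
    have h1 := (hπ s).hasDensity h0
    refine measure_mono_null (t := (t ∩ A) ∪ Aᶜ) ?_ (measure_union_null h1 (hπ s).supported)
    intro x hx
    by_cases hxA : x ∈ A
    · exact Or.inl ⟨hx, hxA⟩
    · exact Or.inr hxA
  have h1 : Kernel.rnDeriv π η s =ᵐ[volume.restrict A] (π s).rnDeriv (volume.restrict A) :=
    Kernel.rnDeriv_eq_rnDeriv_measure
  -- `π s` charges only `A`, so its densities for the restricted and the full Lebesgue measure agree
  -- on `A`.
  have h2 : (π s).rnDeriv (volume.restrict A) =ᵐ[volume.restrict A] (π s).rnDeriv volume := by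
    have h3 : (volume.restrict A).withDensity ((π s).rnDeriv volume) = π s := by
      rw [← restrict_withDensity hAm, Measure.withDensity_rnDeriv_eq _ _ (hπ s).hasDensity]
      exact Measure.restrict_eq_self_of_ae_mem (hπ s).ae_mem
    have h4 := Measure.rnDeriv_withDensity (volume.restrict A)
      (Measure.measurable_rnDeriv (π s) volume)
    rwa [h3] at h4
  filter_upwards [hac.ae_le h1, hac.ae_le h2] with a ha1 ha2
  rw [logDensity, ha1, ha2]

end Kernels

/-! ### Value functions, the Bellman equation, policy improvement and performance difference. -/

namespace MDP

variable {S : Type*} [MeasurableSpace S] (M : MDP S d)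

instance : IsMarkovKernel M.trans := M.isMarkov_trans

instance (π : Kernel S (Act d)) [IsMarkovKernel π] : IsMarkovKernel (M.stateStep π) := by
  unfold stateStep; infer_instance

instance isMarkovKernel_stateLaw (π : Kernel S (Act d)) [IsMarkovKernel π] (t : ℕ) :
    IsMarkovKernel (M.stateLaw π t) := by
  induction t with
  | zero => unfold stateLaw; infer_instance
  | succ t ih => unfold stateLaw; infer_instance

/-- The definition appends the last step; the Bellman equation has to peel off the first. -/
lemma stateLaw_succ' (π : Kernel S (Act d)) (t : ℕ) :
    M.stateLaw π (t + 1) = M.stateLaw π t ∘ₖ M.stateStep π := by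
  induction t with
  | zero => simp [stateLaw]
  | succ t ih =>
    rw [stateLaw, ih, ← Kernel.comp_assoc, ← stateLaw]
    rw [ih]

variable {M}

lemma integral_stateStep {π : Kernel S (Act d)} [IsMarkovKernel π] {f : S → ℝ} {C : ℝ}
    (hf : Measurable f) (hC : ∀ s, |f s| ≤ C) (s : S) :
    ∫ s', f s' ∂(M.stateStep π s) = ∫ a, ∫ s', f s' ∂(M.trans (s, a)) ∂(π s) := by
  rw [stateStep, Kernel.integral_comp (integrable_of_measurable_of_abs_le hf hC),
    Kernel.prod_apply, Kernel.id_apply, Measure.dirac_prod, integral_map]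
  · exact measurable_prodMk_left.aemeasurable
  · exact (hf.stronglyMeasurable.integral_kernel (κ := M.trans)).aestronglyMeasurable

/-- The expected regularized reward of one step under `π`. -/
def stageReward (M : MDP S d) (τ : ℝ) (π : Kernel S (Act d)) (s : S) : ℝ :=
  ∫ a, M.reward (s, a) ∂(π s) - τ * negEntropy (π s)

variable {γ τ R : ℝ} {π : Kernel S (Act d)}

lemma IsPolicy.isMarkovKernel (hπ : M.IsPolicy π) : IsMarkovKernel π :=
  isMarkovKernel_of_isActionLaw hπ.1

lemma IsPolicy.measurable_stageReward (hA : Bornology.IsBounded M.actions) (hπ : M.IsPolicy π) :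
    Measurable (M.stageReward τ π) := by
  have := hπ.isMarkovKernel
  exact (M.measurable_reward.stronglyMeasurable.integral_kernel_prod_right' (κ := π)).measurable.sub
    ((measurable_negEntropy M.measurableSet_actions hA hπ.1).const_mul τ)

lemma IsPolicy.exists_abs_stageReward_le (hR : ∀ s, ∀ a ∈ M.actions, |M.reward (s, a)| ≤ R)
    (hπ : M.IsPolicy π) : ∃ C, ∀ s, |M.stageReward τ π s| ≤ C := by
  obtain ⟨B, hB⟩ := hπ.2
  refine ⟨R + |τ| * B, fun s => ?_⟩
  refine (abs_sub _ _).trans (add_le_add ((hπ.1 s).abs_integral_le (hR s)) ?_)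
  rw [abs_mul]
  exact mul_le_mul_of_nonneg_left (hB s) (abs_nonneg τ)

lemma value_eq_tsum (s : S) :
    M.value γ τ π s = ∑' t : ℕ, γ ^ t * ∫ s', M.stageReward τ π s' ∂(M.stateLaw π t s) := rfl

lemma abs_discounted_term_le (hγ₀ : 0 < γ) [IsMarkovKernel π] {C : ℝ}
    (hC : ∀ s, |M.stageReward τ π s| ≤ C) (t : ℕ) (s : S) :
    |γ ^ t * ∫ s', M.stageReward τ π s' ∂(M.stateLaw π t s)| ≤ γ ^ t * C := by
  rw [abs_mul, abs_of_nonneg (pow_nonneg hγ₀.le t)]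
  exact mul_le_mul_of_nonneg_left (abs_integral_le_of_abs_le hC) (pow_nonneg hγ₀.le t)

lemma summable_value (hγ₀ : 0 < γ) (hγ₁ : γ < 1) [IsMarkovKernel π] {C : ℝ}
    (hC : ∀ s, |M.stageReward τ π s| ≤ C) (s : S) :
    Summable fun t : ℕ => γ ^ t * ∫ s', M.stageReward τ π s' ∂(M.stateLaw π t s) :=
  Summable.of_norm_bounded ((summable_geometric_of_lt_one hγ₀.le hγ₁).mul_right C)
    fun t => abs_discounted_term_le hγ₀ hC t s

lemma IsPolicy.exists_abs_value_le (hγ₀ : 0 < γ) (hγ₁ : γ < 1)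
    (hR : ∀ s, ∀ a ∈ M.actions, |M.reward (s, a)| ≤ R)
    (hπ : M.IsPolicy π) : ∃ C, ∀ s, |M.value γ τ π s| ≤ C := by
  have := hπ.isMarkovKernel
  obtain ⟨C, hC⟩ := hπ.exists_abs_stageReward_le (τ := τ) hR
  refine ⟨∑' t : ℕ, γ ^ t * C, fun s => ?_⟩
  rw [value_eq_tsum]
  refine (Real.norm_eq_abs _).symm.trans_le (tsum_of_norm_bounded ((summable_geometric_of_lt_one hγ₀.le hγ₁).mul_right C).hasSum
    fun t => abs_discounted_term_le hγ₀ hC t s)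

lemma IsPolicy.measurable_integral_stateLaw (hA : Bornology.IsBounded M.actions)
    (hπ : M.IsPolicy π) (t : ℕ) :
    Measurable fun s => ∫ s', M.stageReward τ π s' ∂(M.stateLaw π t s) :=
  ((hπ.measurable_stageReward hA).stronglyMeasurable.integral_kernel
    (κ := M.stateLaw π t)).measurable

lemma IsPolicy.measurable_value (hγ₀ : 0 < γ) (hγ₁ : γ < 1) (hA : Bornology.IsBounded M.actions)
    (hR : ∀ s, ∀ a ∈ M.actions, |M.reward (s, a)| ≤ R) (hπ : M.IsPolicy π) :
    Measurable (M.value γ τ π) := by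
  have := hπ.isMarkovKernel
  obtain ⟨C, hC⟩ := hπ.exists_abs_stageReward_le (τ := τ) hR
  refine measurable_of_tendsto_metrizable (f := fun n s => ∑ t ∈ Finset.range n,
    γ ^ t * ∫ s', M.stageReward τ π s' ∂(M.stateLaw π t s)) (fun n => ?_) ?_
  · exact Finset.measurable_fun_sum _ fun t _ =>
      (hπ.measurable_integral_stateLaw hA t).const_mul _
  · exact tendsto_pi_nhds.2 fun s => (summable_value hγ₀ hγ₁ hC s).hasSum.tendsto_sum_nat

/-- The Bellman equation. -/
lemma IsPolicy.value_eq (hγ₀ : 0 < γ) (hγ₁ : γ < 1) (hA : Bornology.IsBounded M.actions)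
    (hR : ∀ s, ∀ a ∈ M.actions, |M.reward (s, a)| ≤ R) (hπ : M.IsPolicy π) (s : S) :
    M.value γ τ π s
      = M.stageReward τ π s + γ * ∫ s', M.value γ τ π s' ∂(M.stateStep π s) := by
  have := hπ.isMarkovKernel
  obtain ⟨C, hC⟩ := hπ.exists_abs_stageReward_le (τ := τ) hR
  have hcm := hπ.measurable_stageReward (τ := τ) hA
  rw [value_eq_tsum, (summable_value hγ₀ hγ₁ hC s).tsum_eq_zero_add]
  congr 1
  · simp only [pow_zero, one_mul, stateLaw, Kernel.id_apply]
    exact integral_dirac' _ _ hcm.stronglyMeasurable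
  · have h1 : ∀ t : ℕ, γ ^ (t + 1) * ∫ s', M.stageReward τ π s' ∂(M.stateLaw π (t + 1) s)
        = γ * ∫ s', γ ^ t * ∫ s'', M.stageReward τ π s'' ∂(M.stateLaw π t s')
            ∂(M.stateStep π s) := by
      intro t
      rw [integral_const_mul, stateLaw_succ',
        Kernel.integral_comp (integrable_of_measurable_of_abs_le hcm hC)]
      ring
    simp_rw [h1]
    rw [tsum_mul_left]
    congr 1
    have hm : ∀ t : ℕ, Measurable fun s' =>
        γ ^ t * ∫ s'', M.stageReward τ π s'' ∂(M.stateLaw π t s') :=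
      fun t => (hπ.measurable_integral_stateLaw hA t).const_mul _
    refine integral_tsum_of_summable_integral_norm (fun t =>
      integrable_of_measurable_of_abs_le (hm t) fun s' => abs_discounted_term_le hγ₀ hC t s') ?_
    refine Summable.of_norm_bounded ((summable_geometric_of_lt_one hγ₀.le hγ₁).mul_right C)
      fun t => ?_
    exact abs_integral_le_of_abs_le fun s' => by
      rw [Real.norm_eq_abs, abs_abs]; exact abs_discounted_term_le hγ₀ hC t s'

/-- The soft Bellman operator of `π'` applied to the value of `π`. -/
def bellman (M : MDP S d) (γ τ : ℝ) (π π' : Kernel S (Act d)) (s : S) : ℝ :=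
  M.stageReward τ π' s + γ * ∫ s', M.value γ τ π s' ∂(M.stateStep π' s)

variable {π' : Kernel S (Act d)}

lemma IsPolicy.measurable_qValue (hγ₀ : 0 < γ) (hγ₁ : γ < 1) (hA : Bornology.IsBounded M.actions)
    (hR : ∀ s, ∀ a ∈ M.actions, |M.reward (s, a)| ≤ R) (hπ : M.IsPolicy π) :
    Measurable fun p : S × Act d => M.qValue γ τ π p.1 p.2 :=
  M.measurable_reward.add (((hπ.measurable_value hγ₀ hγ₁ hA hR).stronglyMeasurable.integral_kernel
    (κ := M.trans)).measurable.const_mul γ)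

lemma IsPolicy.bellman_eq (hγ₀ : 0 < γ) (hγ₁ : γ < 1) (hA : Bornology.IsBounded M.actions)
    (hR : ∀ s, ∀ a ∈ M.actions, |M.reward (s, a)| ≤ R) (hπ : M.IsPolicy π) (hπ' : M.IsPolicy π')
    (s : S) :
    M.bellman γ τ π π' s
      = ∫ a, M.qValue γ τ π s a ∂(π' s) - τ * negEntropy (π' s) := by
  have := hπ'.isMarkovKernel
  obtain ⟨C, hC⟩ := hπ.exists_abs_value_le (τ := τ) hγ₀ hγ₁ hR
  have hm := hπ.measurable_value (τ := τ) hγ₀ hγ₁ hA hR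
  have i1 : Integrable (fun a => M.reward (s, a)) (π' s) :=
    (hπ'.1 s).integrable_of_bounded
      (M.measurable_reward.comp measurable_prodMk_left).aestronglyMeasurable (hR s)
  have i2 : Integrable (fun a => ∫ s', M.value γ τ π s' ∂(M.trans (s, a))) (π' s) :=
    integrable_of_measurable_of_abs_le
      ((hm.stronglyMeasurable.integral_kernel (κ := M.trans)).measurable.comp
        measurable_prodMk_left) fun a => abs_integral_le_of_abs_le hC
  simp only [bellman, stageReward, qValue]
  rw [integral_stateStep hm hC, integral_add i1 (i2.const_mul γ), integral_const_mul]
  ring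

lemma IsPolicy.measurable_bellman (hγ₀ : 0 < γ) (hγ₁ : γ < 1)
    (hA : Bornology.IsBounded M.actions)
    (hR : ∀ s, ∀ a ∈ M.actions, |M.reward (s, a)| ≤ R) (hπ : M.IsPolicy π) (hπ' : M.IsPolicy π') :
    Measurable (M.bellman γ τ π π') :=
  (hπ'.measurable_stageReward hA).add
    (((hπ.measurable_value hγ₀ hγ₁ hA hR).stronglyMeasurable.integral_kernel
      (κ := M.stateStep π')).measurable.const_mul γ)

lemma IsPolicy.exists_abs_bellman_le (hγ₀ : 0 < γ) (hγ₁ : γ < 1)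
    (hR : ∀ s, ∀ a ∈ M.actions, |M.reward (s, a)| ≤ R) (hπ : M.IsPolicy π) (hπ' : M.IsPolicy π') :
    ∃ C, ∀ s, |M.bellman γ τ π π' s| ≤ C := by
  have := hπ'.isMarkovKernel
  obtain ⟨C, hC⟩ := hπ.exists_abs_value_le (τ := τ) hγ₀ hγ₁ hR
  obtain ⟨C', hC'⟩ := hπ'.exists_abs_stageReward_le (τ := τ) hR
  refine ⟨C' + γ * C, fun s => (abs_add_le _ _).trans (add_le_add (hC' s) ?_)⟩
  rw [abs_mul, abs_of_pos hγ₀]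
  exact mul_le_mul_of_nonneg_left (abs_integral_le_of_abs_le hC) hγ₀.le

/-- If one Bellman step with `π'` loses at most `E`, then `π'` is almost as good as that step. -/
lemma IsPolicy.bellman_sub_le_value (hγ₀ : 0 < γ) (hγ₁ : γ < 1)
    (hA : Bornology.IsBounded M.actions)
    (hR : ∀ s, ∀ a ∈ M.actions, |M.reward (s, a)| ≤ R) (hπ : M.IsPolicy π) (hπ' : M.IsPolicy π')
    {E : ℝ} (hE : ∀ s, M.value γ τ π s - E ≤ M.bellman γ τ π π' s) (s : S) :
    M.bellman γ τ π π' s - γ * E / (1 - γ) ≤ M.value γ τ π' s := by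
  have := hπ'.isMarkovKernel
  obtain ⟨C, hC⟩ := hπ.exists_abs_value_le (τ := τ) hγ₀ hγ₁ hR
  obtain ⟨C', hC'⟩ := hπ'.exists_abs_value_le (τ := τ) hγ₀ hγ₁ hR
  have hm := hπ.measurable_value (τ := τ) hγ₀ hγ₁ hA hR
  have hm' := hπ'.measurable_value (τ := τ) hγ₀ hγ₁ hA hR
  set D : S → ℝ := fun s => M.value γ τ π' s - M.value γ τ π s with hD
  have hbdd : BddBelow (range D) := by
    refine ⟨-(C' + C), ?_⟩
    rintro _ ⟨x, rfl⟩
    have h1 := (abs_le.1 (hC x)).2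
    have h2 := (abs_le.1 (hC' x)).1
    simp only [hD]; linarith
  have hi : ∀ x, Integrable (M.value γ τ π) (M.stateStep π' x) :=
    fun x => integrable_of_measurable_of_abs_le hm hC
  have hi' : ∀ x, Integrable (M.value γ τ π') (M.stateStep π' x) :=
    fun x => integrable_of_measurable_of_abs_le hm' hC'
  have hstep : ∀ x, M.bellman γ τ π π' x + γ * ⨅ y, D y ≤ M.value γ τ π' x := by
    intro x
    have h1 : ⨅ y, D y ≤ ∫ y, D y ∂(M.stateStep π' x) := by
      have h2 := integral_mono (μ := M.stateStep π' x) (integrable_const (⨅ y, D y))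
        ((hi' x).sub (hi x)) (fun y => ciInf_le hbdd y)
      simpa using h2
    simp only [hD] at h1
    rw [integral_sub (hi' x) (hi x)] at h1
    have h3 := mul_le_mul_of_nonneg_left h1 hγ₀.le
    rw [hπ'.value_eq hγ₀ hγ₁ hA hR x, bellman]
    simp only [hD]
    linarith
  have : Nonempty S := ⟨s⟩
  -- The infimum `m` of `V^{π'} - V^π` satisfies `m ≥ -E + γ m`, hence `m ≥ -E / (1 - γ)`.
  have hinf : -E + γ * ⨅ y, D y ≤ ⨅ y, D y :=
    le_ciInf fun x => by
      have h1 := hstep x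
      have h2 := hE x
      simp only [hD] at h1 ⊢; linarith
  have h4 : -E / (1 - γ) ≤ ⨅ y, D y := by
    rw [div_le_iff₀ (by linarith)]; linarith
  have h5 := mul_le_mul_of_nonneg_left h4 hγ₀.le
  have h6 : γ * (-E / (1 - γ)) = -(γ * E / (1 - γ)) := by ring
  linarith [hstep s]

/-- The performance difference identity against the stationary distribution of `πs`. -/
lemma IsPolicy.perf_sub_perf_eq (hγ₀ : 0 < γ) (hγ₁ : γ < 1) (hA : Bornology.IsBounded M.actions)
    (hR : ∀ s, ∀ a ∈ M.actions, |M.reward (s, a)| ≤ R) (hπ : M.IsPolicy π)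
    {πs : Kernel S (Act d)} (hπs : M.IsPolicy πs) {νs : Measure S} (hν : M.IsStationary πs νs) :
    (1 - γ) * (M.perf γ τ νs πs - M.perf γ τ νs π)
      = ∫ s, M.bellman γ τ π πs s ∂νs - M.perf γ τ νs π := by
  have := hπs.isMarkovKernel
  have := hν.1
  -- Stationarity: a step under `πs` preserves averages over `νs`.
  have key : ∀ {f : S → ℝ} {C : ℝ}, Measurable f → (∀ s, |f s| ≤ C) →
      ∫ s, ∫ s', f s' ∂(M.stateStep πs s) ∂νs = ∫ s, f s ∂νs := by
    intro f C hf hC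
    conv_rhs => rw [← hν.2.def]
    rw [Measure.comp_eq_comp_const_apply,
      Kernel.integral_comp (integrable_of_measurable_of_abs_le hf hC), Kernel.const_apply]
  obtain ⟨C, hC⟩ := hπ.exists_abs_value_le (τ := τ) hγ₀ hγ₁ hR
  obtain ⟨C', hC'⟩ := hπs.exists_abs_value_le (τ := τ) hγ₀ hγ₁ hR
  obtain ⟨C'', hC''⟩ := hπs.exists_abs_stageReward_le (τ := τ) hR
  have hm := hπ.measurable_value (τ := τ) hγ₀ hγ₁ hA hR
  have hm' := hπs.measurable_value (τ := τ) hγ₀ hγ₁ hA hR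
  have ic : Integrable (M.stageReward τ πs) νs :=
    integrable_of_measurable_of_abs_le (hπs.measurable_stageReward hA) hC''
  have iP : ∀ {f : S → ℝ} {C : ℝ}, Measurable f → (∀ s, |f s| ≤ C) →
      Integrable (fun s => γ * ∫ s', f s' ∂(M.stateStep πs s)) νs := fun hf hC =>
    (integrable_of_measurable_of_abs_le
      (hf.stronglyMeasurable.integral_kernel (κ := M.stateStep πs)).measurable
      fun s => abs_integral_le_of_abs_le hC).const_mul γ
  have e1 : M.perf γ τ νs πs
      = ∫ s, M.stageReward τ πs s ∂νs + γ * M.perf γ τ νs πs := by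
    conv_lhs => rw [perf, funext (hπs.value_eq (τ := τ) hγ₀ hγ₁ hA hR)]
    rw [integral_add ic (iP hm' hC'), integral_const_mul, key hm' hC', perf]
  have e2 : ∫ s, M.bellman γ τ π πs s ∂νs
      = ∫ s, M.stageReward τ πs s ∂νs + γ * M.perf γ τ νs π := by
    simp_rw [bellman]
    rw [integral_add ic (iP hm hC), integral_const_mul, key hm hC, perf]
  rw [e2]
  linarith

end MDP

/-! ### Lower integrals of functions that need not be measurable. -/

section LowerIntegral

variable {α : Type*} [MeasurableSpace α] {μ : Measure α}

/-- Integration of a pointwise inequality between functions that need not be measurable, up to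
an integrable real-valued term. -/
lemma toReal_lintegral_le_of_le_add {u v : α → ℝ≥0∞} {R : α → ℝ} (hR : Integrable R μ)
    (hv : ∫⁻ x, v x ∂μ ≠ ∞)
    (h : ∀ᵐ x ∂μ, u x + ENNReal.ofReal (-R x) ≤ v x + ENNReal.ofReal (R x)) :
    ∫⁻ x, u x ∂μ ≠ ∞ ∧ (∫⁻ x, u x ∂μ).toReal ≤ (∫⁻ x, v x ∂μ).toReal + ∫ x, R x ∂μ := by
  have hP : ∫⁻ x, ENNReal.ofReal (R x) ∂μ ≠ ∞ := hR.lintegral_lt_top.ne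
  have hN : ∫⁻ x, ENNReal.ofReal (-R x) ∂μ ≠ ∞ := hR.neg.lintegral_lt_top.ne
  have h1 := lintegral_mono_ae h
  have hNm : AEMeasurable (fun x => ENNReal.ofReal (-R x)) μ :=
    hR.1.aemeasurable.neg.ennreal_ofReal
  -- Additivity needs only one measurable summand, here the positive or negative part of `R`.
  rw [lintegral_add_right' _ hNm,
    lintegral_add_right' _ hR.1.aemeasurable.ennreal_ofReal] at h1
  have htop : ∫⁻ x, v x ∂μ + ∫⁻ x, ENNReal.ofReal (R x) ∂μ ≠ ∞ := ENNReal.add_ne_top.2 ⟨hv, hP⟩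
  have hu : ∫⁻ x, u x ∂μ ≠ ∞ := ne_top_of_le_ne_top htop (le_self_add.trans h1)
  refine ⟨hu, ?_⟩
  have h2 := ENNReal.toReal_mono htop h1
  rw [ENNReal.toReal_add hu hN, ENNReal.toReal_add hv hP] at h2
  rw [integral_eq_lintegral_pos_part_sub_lintegral_neg_part hR]
  linarith

lemma lintegral_le_of_lintegral_sq_le [IsProbabilityMeasure μ] {y : α → ℝ≥0∞}
    (hy : AEMeasurable y μ) {σ : ℝ} (hσ : 0 ≤ σ)
    (h : ∫⁻ x, y x ^ 2 ∂μ ≤ ENNReal.ofReal (σ ^ 2)) : ∫⁻ x, y x ∂μ ≤ ENNReal.ofReal σ := by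
  have h1 := ENNReal.lintegral_mul_le_Lp_mul_Lq μ Real.HolderConjugate.two_two hy
    (aemeasurable_const (b := (1 : ℝ≥0∞)))
  simp only [Pi.mul_apply, mul_one, ENNReal.rpow_ofNat, one_pow, lintegral_const, measure_univ,
    ENNReal.one_rpow] at h1
  refine h1.trans ((ENNReal.rpow_le_rpow h (by norm_num)).trans_eq ?_)
  rw [ENNReal.ofReal_rpow_of_nonneg (by positivity) (by norm_num), ← Real.sqrt_eq_rpow,
    Real.sqrt_sq hσ]

/-- Averaging over the noise: `L` and `G` need not be measurable, the integrals are then lower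
integrals. -/
lemma lintegral_le_of_noise [IsProbabilityMeasure μ] {G L : α → ℝ≥0∞} {Z : α → ℝ} {a K σ : ℝ}
    (hZ : Integrable Z μ) (hK : 0 < K) (hσ : 0 ≤ σ)
    (hL : ∫⁻ x, L x ^ 2 ∂μ ≤ ENNReal.ofReal (σ ^ 2))
    (hG : ∀ᵐ x ∂μ, G x ≠ ∞ ∧ (L x ≠ ∞ → (G x).toReal ≤ a + Z x + K * (L x).toReal)) :
    ∫⁻ x, G x ∂μ ≤ ENNReal.ofReal (a + ∫ x, Z x ∂μ + K * σ) := by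
  obtain ⟨g, hgm, hgG, hg⟩ := exists_measurable_le_lintegral_eq μ G
  -- The lower bound on `L` that `hG` forces; unlike `L` it is almost everywhere measurable, so
  -- Cauchy-Schwarz applies to it.
  set y : α → ℝ≥0∞ := fun x => ENNReal.ofReal (((g x).toReal - (a + Z x)) / K) with hy
  have hym : AEMeasurable y μ :=
    ((hgm.ennreal_toReal.aemeasurable.sub
      (hZ.1.aemeasurable.const_add a)).div_const K).ennreal_ofReal
  have hyL : ∀ᵐ x ∂μ, y x ≤ L x := by
    filter_upwards [hG] with x hx
    by_cases hLx : L x = ∞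
    · rw [hLx]; exact le_top
    refine ENNReal.ofReal_le_of_le_toReal ?_
    have h1 := ENNReal.toReal_mono hx.1 (hgG x)
    rw [div_le_iff₀ hK]
    linarith [hx.2 hLx]
  have hyσ : ∫⁻ x, y x ∂μ ≤ ENNReal.ofReal σ := by
    refine lintegral_le_of_lintegral_sq_le hym hσ ((lintegral_mono_ae ?_).trans hL)
    filter_upwards [hyL] with x hx
    gcongr
  have hv : ∫⁻ x, ENNReal.ofReal K * y x ∂μ ≤ ENNReal.ofReal (K * σ) := by
    rw [lintegral_const_mul' _ _ ENNReal.ofReal_ne_top, ENNReal.ofReal_mul hK.le]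
    gcongr
  have hmain := toReal_lintegral_le_of_le_add (u := g) (v := fun x => ENNReal.ofReal K * y x)
    (R := fun x => a + Z x) ((integrable_const a).add hZ)
    (ne_top_of_le_ne_top ENNReal.ofReal_ne_top hv) ?_
  · rw [hg, ← ENNReal.ofReal_toReal hmain.1]
    refine ENNReal.ofReal_le_ofReal (hmain.2.trans ?_)
    have h1 := ENNReal.toReal_le_of_le_ofReal (mul_nonneg hK.le hσ) hv
    rw [integral_add (integrable_const a) hZ]
    simp only [integral_const, probReal_univ, one_smul]
    linarith
  · filter_upwards [hG] with x hx
    have hgx : g x ≠ ∞ := ne_top_of_le_ne_top hx.1 (hgG x)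
    rw [← ENNReal.ofReal_mul hK.le, mul_div_cancel₀ _ hK.ne']
    rcases le_total 0 (a + Z x) with h0 | h0
    · rw [ENNReal.ofReal_of_nonpos (by linarith : -(a + Z x) ≤ 0), add_zero]
      conv_lhs => rw [← ENNReal.ofReal_toReal hgx]
      refine le_trans (ENNReal.ofReal_le_ofReal ?_) ENNReal.ofReal_add_le
      linarith
    · conv_lhs => rw [← ENNReal.ofReal_toReal hgx]
      rw [← ENNReal.ofReal_add ENNReal.toReal_nonneg (by linarith), ← sub_eq_add_neg]
      exact le_self_add

end LowerIntegral

/-! ### One proximal step: admissibility, contraction and error terms. -/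

namespace MDP

variable {S : Type*} [MeasurableSpace S] {M : MDP S d} {γ τ R : ℝ} {π π' : Kernel S (Act d)}

/-- Staying at `π` is a competitor with zero transport cost, so a step raises `H` by at most `2 B /
τ`; the volume of the action set gives the lower bound. -/
lemma IsPolicy.of_isProxStep (hA : Bornology.IsBounded M.actions) (hτ : 0 < τ) {η B : ℝ}
    (hη : 0 < η) {f : S → Act d → ℝ} (hB : ∀ s, ∀ a ∈ M.actions, |f s a| ≤ B)
    (hπ : M.IsPolicy π) (hprox : ∀ s, IsProxStep M.actions τ η (f s) (π s) (π' s)) :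
    M.IsPolicy π' := by
  refine ⟨fun s => (hprox s).1, ?_⟩
  obtain ⟨b, hb⟩ := hπ.2
  refine ⟨(volume M.actions).toReal + 2 * B / τ + b, fun s => ?_⟩
  have hvol : (0 : ℝ) ≤ (volume M.actions).toReal := ENNReal.toReal_nonneg
  have h1 := (hprox s).1.neg_volume_le_negEntropy M.measurableSet_actions hA
  have h2 := (hprox s).2 _ (hπ.1 s)
  have h3 := abs_le.1 ((hπ.1 s).abs_integral_le (hB s))
  have h4 := abs_le.1 ((hprox s).1.abs_integral_le (hB s))
  have h5 := abs_le.1 (hb s)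
  have h6 : 0 ≤ 1 / (2 * η) * (W2sq (π' s) (π s)).toReal :=
    mul_nonneg (by positivity) ENNReal.toReal_nonneg
  simp only [proxObjective, W2sq_self, ENNReal.toReal_zero, mul_zero, sub_zero] at h2
  have hB0 : 0 ≤ 2 * B / τ := div_nonneg (by linarith) hτ.le
  have hb0 : 0 ≤ b := (abs_nonneg _).trans (hb s)
  refine abs_le.2 ⟨by linarith, ?_⟩
  have h7 : negEntropy (π' s) - negEntropy (π s) ≤ 2 * B / τ := by
    rw [le_div_iff₀ hτ]; linarith
  linarith

lemma policyDist_ne_top (hA : Bornology.IsBounded M.actions) {νs : Measure S}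
    [IsProbabilityMeasure νs] (hπ : ∀ s, IsActionLaw M.actions (π s))
    (hπ' : ∀ s, IsActionLaw M.actions (π' s)) : policyDist νs π π' ≠ ∞ := by
  refine ne_top_of_le_ne_top (b := ENNReal.ofReal (Metric.diam M.actions ^ 2))
    ENNReal.ofReal_ne_top ?_
  calc policyDist νs π π' ≤ ∫⁻ _, ENNReal.ofReal (Metric.diam M.actions ^ 2) ∂νs := by
        refine lintegral_mono fun s => ?_
        have := (hπ s).isProb
        have := (hπ' s).isProb
        refine le_trans ?_ (W2sq_le_of_bounded hA (hπ s).supported (hπ' s).supported)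
        exact mul_le_of_le_one_left zero_le (ENNReal.inv_le_one.2 (by norm_num))
    _ = _ := by simp

variable {πs : Kernel S (Act d)} {νs : Measure S}

lemma perf_le_of_isOptimal (hγ₀ : 0 < γ) (hγ₁ : γ < 1) (hA : Bornology.IsBounded M.actions)
    (hR : ∀ s, ∀ a ∈ M.actions, |M.reward (s, a)| ≤ R) (hopt : M.IsOptimal γ τ πs)
    [IsProbabilityMeasure νs] (hπ : M.IsPolicy π) :
    M.perf γ τ νs π ≤ M.perf γ τ νs πs := by
  obtain ⟨C, hC⟩ := hπ.exists_abs_value_le (τ := τ) hγ₀ hγ₁ hR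
  obtain ⟨C', hC'⟩ := hopt.1.exists_abs_value_le (τ := τ) hγ₀ hγ₁ hR
  exact integral_mono (integrable_of_measurable_of_abs_le (hπ.measurable_value hγ₀ hγ₁ hA hR) hC)
    (integrable_of_measurable_of_abs_le (hopt.1.measurable_value hγ₀ hγ₁ hA hR) hC')
    (hopt.2 π hπ)

lemma gap_ne_top {lam : ℝ} (hA : Bornology.IsBounded M.actions) [IsProbabilityMeasure νs]
    (hπ : M.IsPolicy π) (hπs : M.IsPolicy πs) : M.gap γ τ lam νs πs π ≠ ∞ :=
  ENNReal.add_ne_top.2 ⟨ENNReal.ofReal_ne_top,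
    ENNReal.mul_ne_top ENNReal.ofReal_ne_top (policyDist_ne_top hA hπ.1 hπs.1)⟩

/-- Optimality of `πs` makes the truncation at zero in `gap` inactive. -/
lemma toReal_gap {lam : ℝ} (hγ₀ : 0 < γ) (hγ₁ : γ < 1) (hA : Bornology.IsBounded M.actions)
    (hR : ∀ s, ∀ a ∈ M.actions, |M.reward (s, a)| ≤ R) (hlam : 0 ≤ lam * τ)
    (hopt : M.IsOptimal γ τ πs) [IsProbabilityMeasure νs] (hπ : M.IsPolicy π) :
    (M.gap γ τ lam νs πs π).toReal
      = M.perf γ τ νs πs - M.perf γ τ νs π + lam * τ * (policyDist νs π πs).toReal := by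
  rw [gap, ENNReal.toReal_add ENNReal.ofReal_ne_top
    (ENNReal.mul_ne_top ENNReal.ofReal_ne_top (policyDist_ne_top hA hπ.1 hopt.1.1)),
    ENNReal.toReal_mul, ENNReal.toReal_ofReal hlam, ENNReal.toReal_ofReal
    (sub_nonneg.2 (perf_le_of_isOptimal hγ₀ hγ₁ hA hR hopt hπ))]

/-- Contraction of the Lyapunov gap in one proximal step driven by an arbitrary bounded
estimate `f` of the soft Q-function. -/
lemma gap_step {lam η B B' E : ℝ} (hγ₀ : 0 < γ) (hγ₁ : γ < 1) (hτ : 0 < τ) (hlam : 0 < lam)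
    (hη : 1 / (γ * lam * τ) ≤ η) (hA : Bornology.IsBounded M.actions)
    (hR : ∀ s, ∀ a ∈ M.actions, |M.reward (s, a)| ≤ R) (hopt : M.IsOptimal γ τ πs)
    (hν : M.IsStationary πs νs) (hπ : M.IsPolicy π) (hπ' : M.IsPolicy π')
    {f : S → Act d → ℝ} (hf : Measurable fun p : S × Act d => f p.1 p.2)
    (hB : ∀ s, ∀ a ∈ M.actions, |f s a| ≤ B)
    (hB' : ∀ s, ∀ a ∈ M.actions, |M.qValue γ τ π s a| ≤ B')
    (hprox : ∀ s, IsProxStep M.actions τ η (f s) (π s) (π' s))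
    (hT : ∀ s, SatisfiesT2 lam (π' s))
    (hE : ∀ s, ∫ a, (f s a - M.qValue γ τ π s a) ∂(π' s)
      - ∫ a, (f s a - M.qValue γ τ π s a) ∂(π s)
      - 1 / (2 * η) * (W2sq (π' s) (π s)).toReal ≤ E) :
    (M.gap γ τ lam νs πs π').toReal ≤ γ * (M.gap γ τ lam νs πs π).toReal
      + (∫ s, ∫ a, (f s a - M.qValue γ τ π s a) ∂(π s) ∂νs
        - ∫ s, ∫ a, (f s a - M.qValue γ τ π s a) ∂(πs s) ∂νs) + E / (1 - γ) := by
  have := hν.1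
  have hη₀ : 0 < η := lt_of_lt_of_le (by positivity) hη
  have hAm := M.measurableSet_actions
  have hπs := hopt.1
  rw [toReal_gap hγ₀ hγ₁ hA hR (by positivity) hopt hπ,
    toReal_gap hγ₀ hγ₁ hA hR (by positivity) hopt hπ']
  have hQm := hπ.measurable_qValue (τ := τ) hγ₀ hγ₁ hA hR
  have hfs : ∀ s, Measurable (f s) := fun s => hf.comp measurable_prodMk_left
  have hQs : ∀ s, Measurable (M.qValue γ τ π s) := fun s => hQm.comp measurable_prodMk_left
  have hsplit : ∀ {p : Kernel S (Act d)}, M.IsPolicy p → ∀ s,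
      ∫ a, f s a ∂(p s) = ∫ a, M.qValue γ τ π s a ∂(p s)
        + ∫ a, (f s a - M.qValue γ τ π s a) ∂(p s) := by
    intro p hp s
    rw [integral_sub ((hp.1 s).integrable_of_bounded (hfs s).aestronglyMeasurable (hB s))
      ((hp.1 s).integrable_of_bounded (hQs s).aestronglyMeasurable (hB' s))]
    ring
  have hb : ∀ s, ∀ a ∈ M.actions, |f s a - M.qValue γ τ π s a| ≤ B + B' := fun s a ha =>
    (abs_sub _ _).trans (add_le_add (hB s a ha) (hB' s a ha))
  have hδi : ∀ {p : Kernel S (Act d)}, M.IsPolicy p →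
      Integrable (fun s => ∫ a, (f s a - M.qValue γ τ π s a) ∂(p s)) νs := by
    intro p hp
    have := hp.isMarkovKernel
    exact integrable_of_measurable_of_abs_le
      ((hf.sub hQm).stronglyMeasurable.integral_kernel_prod_right' (κ := p)).measurable
      fun s => (hp.1 s).abs_integral_le (hb s)
  have hbi : ∀ {p : Kernel S (Act d)}, M.IsPolicy p →
      Integrable (M.bellman γ τ π p) νs := by
    intro p hp
    obtain ⟨C, hC⟩ := hπ.exists_abs_bellman_le (τ := τ) hγ₀ hγ₁ hR hp
    exact integrable_of_measurable_of_abs_le (hπ.measurable_bellman hγ₀ hγ₁ hA hR hp) hC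
  have hvi : ∀ {p : Kernel S (Act d)}, M.IsPolicy p → Integrable (M.value γ τ p) νs := by
    intro p hp
    obtain ⟨C, hC⟩ := hp.exists_abs_value_le (τ := τ) hγ₀ hγ₁ hR
    exact integrable_of_measurable_of_abs_le (hp.measurable_value hγ₀ hγ₁ hA hR) hC
  -- Approximate policy improvement: the competitor is `π` itself.
  have himp : ∀ s, M.value γ τ π s - E ≤ M.bellman γ τ π π' s := by
    intro s
    have h1 := (hprox s).2 _ (hπ.1 s)
    simp only [proxObjective, W2sq_self, ENNReal.toReal_zero, mul_zero, sub_zero] at h1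
    have h2 : M.value γ τ π s = M.bellman γ τ π π s := hπ.value_eq hγ₀ hγ₁ hA hR s
    rw [h2, hπ.bellman_eq hγ₀ hγ₁ hA hR hπ, hπ.bellman_eq hγ₀ hγ₁ hA hR hπ']
    rw [hsplit hπ s, hsplit hπ' s] at h1
    linarith [hE s]
  set Rm : S → ℝ := fun s => M.bellman γ τ π π' s - M.bellman γ τ π πs s + E
    + (∫ a, (f s a - M.qValue γ τ π s a) ∂(π s)
      - ∫ a, (f s a - M.qValue γ τ π s a) ∂(πs s)) with hRm
  have hRi : Integrable Rm νs :=
    (((hbi hπ').sub (hbi hπs)).add (integrable_const E)).add ((hδi hπ).sub (hδi hπs))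
  have hRint : ∫ s, Rm s ∂νs = ∫ s, M.bellman γ τ π π' s ∂νs - ∫ s, M.bellman γ τ π πs s ∂νs + E
      + (∫ s, ∫ a, (f s a - M.qValue γ τ π s a) ∂(π s) ∂νs
        - ∫ s, ∫ a, (f s a - M.qValue γ τ π s a) ∂(πs s) ∂νs) := by
    have h1 := integral_add (((hbi hπ').sub (hbi hπs)).add (integrable_const E))
      ((hδi hπ).sub (hδi hπs))
    have h2 := integral_add ((hbi hπ').sub (hbi hπs)) (integrable_const E)
    have h3 := integral_sub (hbi hπ') (hbi hπs)
    have h4 := integral_sub (hδi hπ) (hδi hπs)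
    simp only [Pi.add_apply, Pi.sub_apply, integral_const, probReal_univ, one_smul] at h1 h2 h3 h4
    rw [hRm, h1, h2, h3, h4]
  -- The three-point inequality: the competitor is `πs`, and the `τ H` terms combine with `Q` into
  -- Bellman images.
  have hpt : ∀ s, lam * τ / 2 * (W2sq (π' s) (πs s)).toReal
      ≤ 1 / (2 * η) * (W2sq (π s) (πs s)).toReal + Rm s := by
    intro s
    have h1 := (hprox s).add_W2sq_le hAm hA hτ hη₀ hlam (hfs s) (hB s) (hπ.1 s) (hT s) (hπs.1 s)
    simp only [proxObjective] at h1
    rw [hsplit hπs s, hsplit hπ' s, W2sq_comm (πs s) (π' s), W2sq_comm (πs s) (π s)] at h1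
    simp only [hRm]
    rw [hπ.bellman_eq hγ₀ hγ₁ hA hR hπs, hπ.bellman_eq hγ₀ hγ₁ hA hR hπ']
    linarith [hE s]
  have hD : ∀ {p : Kernel S (Act d)}, M.IsPolicy p → ∀ c : ℝ, 0 ≤ c →
      ∫⁻ s, ENNReal.ofReal (c / 2 * (W2sq (p s) (πs s)).toReal) ∂νs
        = ENNReal.ofReal c * policyDist νs p πs := by
    intro p hp c hc
    rw [policyDist, ← lintegral_const_mul' _ _ ENNReal.ofReal_ne_top]
    refine lintegral_congr fun s => ?_
    rw [ENNReal.ofReal_mul (by positivity), ENNReal.ofReal_toReal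
      ((hp.1 s).W2sq_ne_top hA (hπs.1 s)), ← mul_assoc, div_eq_mul_inv, ENNReal.ofReal_mul hc,
      ENNReal.ofReal_inv_of_pos (by norm_num), ENNReal.ofReal_ofNat]
  have hDn := policyDist_ne_top (νs := νs) hA hπ.1 hπs.1
  have hmain := toReal_lintegral_le_of_le_add (μ := νs)
    (u := fun s => ENNReal.ofReal (lam * τ / 2 * (W2sq (π' s) (πs s)).toReal))
    (v := fun s => ENNReal.ofReal (1 / η / 2 * (W2sq (π s) (πs s)).toReal)) hRi
    (by rw [hD hπ _ (by positivity)]; exact ENNReal.mul_ne_top ENNReal.ofReal_ne_top hDn)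
    (.of_forall fun s => by
      have h1 := hpt s
      have e : 1 / η / 2 = 1 / (2 * η) := by field_simp
      rw [e]
      have h2 : 0 ≤ lam * τ / 2 * (W2sq (π' s) (πs s)).toReal :=
        mul_nonneg (by positivity) ENNReal.toReal_nonneg
      have h3 : 0 ≤ 1 / (2 * η) * (W2sq (π s) (πs s)).toReal :=
        mul_nonneg (by positivity) ENNReal.toReal_nonneg
      rcases le_total 0 (Rm s) with h0 | h0
      · rw [ENNReal.ofReal_of_nonpos (by linarith : -Rm s ≤ 0), add_zero,
          ← ENNReal.ofReal_add h3 h0]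
        exact ENNReal.ofReal_le_ofReal h1
      · rw [ENNReal.ofReal_of_nonpos h0, add_zero, ← ENNReal.ofReal_add h2 (by linarith)]
        exact ENNReal.ofReal_le_ofReal (by linarith))
  have hfin := hmain.2
  rw [hD hπ' _ (by positivity), hD hπ _ (by positivity), ENNReal.toReal_mul, ENNReal.toReal_mul,
    ENNReal.toReal_ofReal (by positivity), ENNReal.toReal_ofReal (by positivity), hRint] at hfin
  have hperf := hπ.perf_sub_perf_eq (τ := τ) hγ₀ hγ₁ hA hR hπs hν
  have hval : ∫ s, M.bellman γ τ π π' s ∂νs - γ * E / (1 - γ) ≤ M.perf γ τ νs π' := by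
    have h1 := integral_mono ((hbi hπ').sub (integrable_const (γ * E / (1 - γ)))) (hvi hπ')
      (hπ.bellman_sub_le_value hγ₀ hγ₁ hA hR hπ' himp)
    simp only [Pi.sub_apply] at h1
    rw [integral_sub (hbi hπ') (integrable_const _)] at h1
    simpa [perf] using h1
  -- The step size condition makes the distance term contract by `γ`.
  have hηle : 1 / η ≤ γ * (lam * τ) := by
    rw [div_le_iff₀ hη₀]
    rw [div_le_iff₀ (by positivity)] at hη
    linarith
  have h5 := mul_le_mul_of_nonneg_right hηle
    (ENNReal.toReal_nonneg (a := policyDist νs π πs))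
  -- One `E` comes from the three-point inequality, `γ E / (1 - γ)` from policy improvement.
  have h6 : E / (1 - γ) = E + γ * E / (1 - γ) := by
    have : (1 - γ) ≠ 0 := by linarith
    field_simp; ring
  rw [h6]
  linarith

/-- The error made by the gradient noise, in a form that is linear in the gradient distance. -/
lemma noise_error_le {η B ε : ℝ} (hη : 0 < η) (hB₀ : 0 ≤ B)
    (hAc : Convex ℝ M.actions) (hA : Bornology.IsBounded M.actions)
    (hπ : M.IsPolicy π) (hπ' : M.IsPolicy π') {f g : S → Act d → ℝ}
    (hf : ∀ s, Measurable (f s)) (hg : ∀ s, Measurable (g s))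
    (hfB : ∀ s, ∀ a ∈ M.actions, |f s a| ≤ B) (hgB : ∀ s, ∀ a ∈ M.actions, |g s a| ≤ B + ε)
    (hfd : ∀ s, DifferentiableOn ℝ (f s) M.actions)
    (hgd : ∀ s, DifferentiableOn ℝ (g s) M.actions) (hε : 0 ≤ ε)
    (hL : gradSupDist M.actions f g ≠ ∞) (s : S) :
    ∫ a, (f s a - g s a) ∂(π' s) - ∫ a, (f s a - g s a) ∂(π s)
      - 1 / (2 * η) * (W2sq (π' s) (π s)).toReal
      ≤ (η / 2 + 4 * B + 1) * (gradSupDist M.actions f g).toReal + 2 * ε := by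
  have := (hπ.1 s).isProb
  have := (hπ'.1 s).isProb
  have hb : ∀ a ∈ M.actions, |f s a - g s a| ≤ B + (B + ε) := fun a ha =>
    (abs_sub _ _).trans (add_le_add (hfB s a ha) (hgB s a ha))
  set L := (gradSupDist M.actions f g).toReal
  have hL0 : 0 ≤ L := ENNReal.toReal_nonneg
  -- For `L ≤ 1`, the transport bound `η L² / 2` is at most `η L / 2`. For `L ≥ 1`, boundedness
  -- gives `4 B + 2 ε`, and `4 B ≤ 4 B L`. The result is linear in `σ` without assuming `σ ≤ 1`.
  rcases le_total L 1 with h1 | h1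
  · have h2 := integral_sub_le_W2sq (hπ'.1 s).supported (hπ.1 s).supported hη
      ((hπ'.1 s).integrable_of_bounded ((hf s).sub (hg s)).aestronglyMeasurable hb)
      ((hπ.1 s).integrable_of_bounded ((hf s).sub (hg s)).aestronglyMeasurable hb)
      (fun x hx y hy => abs_sub_le_gradSupDist hAc hL s (hfd s) (hgd s) hx hy)
      ((hπ'.1 s).W2sq_ne_top hA (hπ.1 s))
    simp only [Pi.sub_apply] at h2
    have h3 : η * L ^ 2 ≤ η * L := mul_le_mul_of_nonneg_left (by nlinarith) hη.le
    have h4 : 0 ≤ (4 * B + 1) * L := by positivity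
    change _ ≤ η * L ^ 2 / 2 at h2
    linarith
  · have h2 := abs_le.1 ((hπ'.1 s).abs_integral_le hb)
    have h3 := abs_le.1 ((hπ.1 s).abs_integral_le hb)
    have h4 : 0 ≤ 1 / (2 * η) * (W2sq (π' s) (π s)).toReal :=
      mul_nonneg (by positivity) ENNReal.toReal_nonneg
    nlinarith

/-- Averaging the estimation error over the noise leaves only the bias. -/
lemma integrable_and_abs_integral_bias_le {Ξ : Type*} [MeasurableSpace Ξ] {μ : Measure Ξ}
    [IsProbabilityMeasure μ] [IsProbabilityMeasure νs] (hπ : M.IsPolicy π)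
    {F : Ξ → S → Act d → ℝ} {g : S → Act d → ℝ} {B B' ε : ℝ}
    (hF : Measurable fun x : Ξ × S × Act d => F x.1 x.2.1 x.2.2)
    (hg : Measurable fun p : S × Act d => g p.1 p.2)
    (hFB : ∀ᵐ ξ ∂μ, ∀ s, ∀ a ∈ M.actions, |F ξ s a| ≤ B)
    (hgB : ∀ s, ∀ a ∈ M.actions, |g s a| ≤ B')
    (hε : ∀ s, ∀ a ∈ M.actions, |∫ ξ, F ξ s a ∂μ - g s a| ≤ ε) :
    Integrable (fun ξ => ∫ s, ∫ a, (F ξ s a - g s a) ∂(π s) ∂νs) μ ∧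
      |∫ ξ, ∫ s, ∫ a, (F ξ s a - g s a) ∂(π s) ∂νs ∂μ| ≤ ε := by
  have := hπ.isMarkovKernel
  set ρ : Measure (S × Act d) := νs ⊗ₘ π with hρ
  have hρA : ∀ᵐ p ∂ρ, p.2 ∈ M.actions := by
    rw [hρ, Measure.ae_compProd_iff (measurable_snd M.measurableSet_actions)]
    exact .of_forall fun s => (hπ.1 s).ae_mem
  have hHm : Measurable fun x : Ξ × S × Act d => F x.1 x.2.1 x.2.2 - g x.2.1 x.2.2 :=
    hF.sub (hg.comp measurable_snd)
  have hHb : ∀ᵐ ξ ∂μ, ∀ s, ∀ a ∈ M.actions, |F ξ s a - g s a| ≤ B + B' := by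
    filter_upwards [hFB] with ξ hξ s a ha
    exact (abs_sub _ _).trans (add_le_add (hξ s a ha) (hgB s a ha))
  have hHi : Integrable (fun x : Ξ × S × Act d => F x.1 x.2.1 x.2.2 - g x.2.1 x.2.2)
      (μ.prod ρ) := by
    refine Integrable.of_bound hHm.aestronglyMeasurable (B + B') ?_
    refine (Measure.ae_prod_iff_ae_ae (measurableSet_le hHm.norm measurable_const)).2 ?_
    filter_upwards [hHb] with ξ hξ
    filter_upwards [hρA] with p hp using hξ _ _ hp
  have hcongr : (fun ξ => ∫ p, (F ξ p.1 p.2 - g p.1 p.2) ∂ρ)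
      =ᵐ[μ] fun ξ => ∫ s, ∫ a, (F ξ s a - g s a) ∂(π s) ∂νs := by
    filter_upwards [hHb] with ξ hξ
    refine Measure.integral_compProd (Integrable.of_bound
      (hHm.comp measurable_prodMk_left).aestronglyMeasurable (B + B') ?_)
    filter_upwards [hρA] with p hp using hξ _ _ hp
  refine ⟨hHi.integral_prod_left.congr hcongr, ?_⟩
  -- The law `ρ` does not depend on the noise, so Fubini lets the noise be averaged first.
  rw [← integral_congr_ae hcongr,
    integral_integral_swap (f := fun ξ (p : S × Act d) => F ξ p.1 p.2 - g p.1 p.2) hHi]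
  have hle : ∀ᵐ p ∂ρ, ‖∫ ξ, (F ξ p.1 p.2 - g p.1 p.2) ∂μ‖ ≤ ε := by
    filter_upwards [hρA] with p hp
    have hi : Integrable (fun ξ => F ξ p.1 p.2) μ := by
      refine Integrable.of_bound
        (hF.comp (measurable_id.prodMk measurable_const)).aestronglyMeasurable B ?_
      filter_upwards [hFB] with ξ hξ using hξ _ _ hp
    rw [integral_sub hi (integrable_const _)]
    simpa using hε _ _ hp
  simpa using norm_integral_le_of_norm_le_const hle

end MDP

/-! ### The law of the sampling history and the scalar recursion. -/

section History

lemma histSnoc_castSucc {Ξ : Type*} {k : ℕ} (h : Fin k → Ξ) (ξ : Ξ) :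
    (fun i : Fin k => histSnoc h ξ i.castSucc) = h := by
  funext i
  simp [histSnoc]

variable {Ξ : Type*} [MeasurableSpace Ξ]

lemma measurable_histSnoc (k : ℕ) :
    Measurable fun p : (Fin k → Ξ) × Ξ => histSnoc p.1 p.2 := by
  refine measurable_pi_iff.2 fun i => ?_
  refine Fin.lastCases ?_ (fun j => ?_) i
  · simpa [histSnoc] using measurable_snd
  · simpa [histSnoc, Function.comp_def] using
      (measurable_pi_apply j).comp (measurable_fst (α := Fin k → Ξ) (β := Ξ))

variable {κ : (k : ℕ) → Kernel (Fin k → Ξ) Ξ} [∀ k, IsMarkovKernel (κ k)]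

instance isProbabilityMeasure_histLaw (k : ℕ) : IsProbabilityMeasure (histLaw κ k) := by
  induction k with
  | zero => unfold histLaw; infer_instance
  | succ k ih =>
    unfold histLaw
    exact Measure.isProbabilityMeasure_map (measurable_histSnoc k).aemeasurable

lemma ae_ae_of_ae_histLaw_succ {k : ℕ} {p : (Fin (k + 1) → Ξ) → Prop}
    (h : ∀ᵐ x ∂(histLaw κ (k + 1)), p x) :
    ∀ᵐ x ∂(histLaw κ k), ∀ᵐ ξ ∂(κ k x), p (histSnoc x ξ) := by
  rw [histLaw] at h
  exact Measure.ae_ae_of_ae_compProd (ae_of_ae_map (measurable_histSnoc k).aemeasurable h)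

/-- Forgetting the last noise variable maps the law of the longer history to that of the shorter
one. -/
lemma ae_histLaw_succ_of_ae {k : ℕ} {p : (Fin k → Ξ) → Prop}
    (h : ∀ᵐ x ∂(histLaw κ k), p x) :
    ∀ᵐ x ∂(histLaw κ (k + 1)), p fun i => x i.castSucc := by
  have hm : Measurable fun (x : Fin (k + 1) → Ξ) (i : Fin k) => x i.castSucc :=
    measurable_pi_iff.2 fun i => measurable_pi_apply _
  have hmap : (histLaw κ (k + 1)).map (fun x (i : Fin k) => x i.castSucc) = histLaw κ k := by
    rw [histLaw, Measure.map_map hm (measurable_histSnoc k)]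
    have : (fun (x : Fin (k + 1) → Ξ) (i : Fin k) => x i.castSucc)
        ∘ (fun p : (Fin k → Ξ) × Ξ => histSnoc p.1 p.2) = Prod.fst :=
      funext fun p => histSnoc_castSucc p.1 p.2
    rw [this]
    exact Measure.fst_compProd _ _
  exact ae_of_ae_map hm.aemeasurable (hmap.symm ▸ h)

/-- Disintegration of a measurable minorant of `G` with the same integral; without measurability of
`G` only this inequality is obtained. -/
lemma lintegral_histLaw_succ_le {k : ℕ} (G : (Fin (k + 1) → Ξ) → ℝ≥0∞) :
    ∫⁻ x, G x ∂(histLaw κ (k + 1))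
      ≤ ∫⁻ x, ∫⁻ ξ, G (histSnoc x ξ) ∂(κ k x) ∂(histLaw κ k) := by
  obtain ⟨g, hgm, hgG, hg⟩ := exists_measurable_le_lintegral_eq (histLaw κ (k + 1)) G
  rw [hg, histLaw, lintegral_map hgm (measurable_histSnoc k),
    Measure.lintegral_compProd (f := fun p => g (histSnoc p.1 p.2))
      (hgm.comp (measurable_histSnoc k))]
  exact lintegral_mono fun x => lintegral_mono fun ξ => hgG _

end History

/-- Solution of the scalar recursion `a (k + 1) ≤ γ a k + c`. -/
lemma le_pow_mul_add_of_le_mul_add {γ c : ℝ} (hγ₀ : 0 < γ) (hγ₁ : γ < 1) (hc : 0 ≤ c)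
    {a : ℕ → ℝ≥0∞} (h : ∀ k, a (k + 1) ≤ ENNReal.ofReal γ * a k + ENNReal.ofReal c) (k : ℕ) :
    a k ≤ ENNReal.ofReal (γ ^ k) * a 0 + ENNReal.ofReal (c / (1 - γ)) := by
  have h1γ : 0 < 1 - γ := by linarith
  induction k with
  | zero => simp
  | succ k ih =>
    calc a (k + 1) ≤ ENNReal.ofReal γ * a k + ENNReal.ofReal c := h k
      _ ≤ ENNReal.ofReal γ * (ENNReal.ofReal (γ ^ k) * a 0 + ENNReal.ofReal (c / (1 - γ)))
          + ENNReal.ofReal c := by gcongr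
      _ = ENNReal.ofReal (γ ^ (k + 1)) * a 0 + ENNReal.ofReal (γ * (c / (1 - γ)) + c) := by
          rw [mul_add, ← mul_assoc, ← ENNReal.ofReal_mul hγ₀.le, ← ENNReal.ofReal_mul hγ₀.le,
            add_assoc, ← ENNReal.ofReal_add (by positivity) hc, pow_succ']
      _ = _ := by
          congr 2
          field_simp
          ring

/-- Take logarithms and use `log γ ≤ γ - 1`. The case `Δ = 0` is separate because `Real.log 0 = 0`.
-/
lemma pow_mul_le_of_log_le {γ Δ δ : ℝ} (hγ₀ : 0 < γ) (hγ₁ : γ < 1) (hΔ : 0 ≤ Δ) (hδ : 0 < δ)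
    {k : ℕ} (hk : 1 / (1 - γ) * Real.log (Δ / δ) ≤ k) : γ ^ k * Δ ≤ δ := by
  rcases hΔ.eq_or_lt with rfl | hΔ
  · simpa using hδ.le
  have h1γ : 0 < 1 - γ := by linarith
  rw [one_div, inv_mul_le_iff₀ h1γ] at hk
  have h1 : Real.log γ ≤ γ - 1 := Real.log_le_sub_one_of_pos hγ₀
  have h2 : (k : ℝ) * Real.log γ ≤ k * (γ - 1) := mul_le_mul_of_nonneg_left h1 k.cast_nonneg
  rw [Real.log_div hΔ.ne' hδ.ne'] at hk
  rw [← Real.log_le_log_iff (by positivity) hδ, Real.log_mul (by positivity) hΔ.ne', Real.log_pow]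
  linarith

/-! ### The conditional expectation of one stochastic step. -/

namespace MDP

variable {S : Type*} [MeasurableSpace S] {M : MDP S d} {π : Kernel S (Act d)}
  {πs : Kernel S (Act d)} {νs : Measure S}

/-- One stochastic proximal step, conditionally on the past: `π` is the current policy, `π' ξ` the
next one and `F ξ` the estimate of its soft Q-function. -/
lemma lintegral_gap_step_le {Ξ : Type*} [MeasurableSpace Ξ] {μ : Measure Ξ}
    [IsProbabilityMeasure μ] {γ τ lam η B R ε σ : ℝ}
    (hγ₀ : 0 < γ) (hγ₁ : γ < 1) (hτ : 0 < τ) (hlam : 0 < lam)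
    (hη : 1 / (γ * lam * τ) ≤ η) (hAc : Convex ℝ M.actions) (hA : Bornology.IsBounded M.actions)
    (hR : ∀ s, ∀ a ∈ M.actions, |M.reward (s, a)| ≤ R) (hopt : M.IsOptimal γ τ πs)
    (hν : M.IsStationary πs νs) (hπ : M.IsPolicy π) {π' : Ξ → Kernel S (Act d)}
    {F : Ξ → S → Act d → ℝ} (hF : Measurable fun x : Ξ × S × Act d => F x.1 x.2.1 x.2.2)
    (hFB : ∀ᵐ ξ ∂μ, ∀ s, ∀ a ∈ M.actions, |F ξ s a| ≤ B)
    (hFd : ∀ᵐ ξ ∂μ, ∀ s, DifferentiableOn ℝ (F ξ s) M.actions)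
    (hQd : ∀ s, DifferentiableOn ℝ (M.qValue γ τ π s) M.actions)
    (hε : ∀ s, ∀ a ∈ M.actions, |∫ ξ, F ξ s a ∂μ - M.qValue γ τ π s a| ≤ ε)
    (hσ₀ : 0 ≤ σ)
    (hσ : ∫⁻ ξ, gradSupDist M.actions (F ξ) (M.qValue γ τ π) ^ 2 ∂μ ≤ ENNReal.ofReal (σ ^ 2))
    (hprox : ∀ᵐ ξ ∂μ, ∀ s, IsProxStep M.actions τ η (F ξ s) (π s) (π' ξ s))
    (hT : ∀ᵐ ξ ∂μ, ∀ s, SatisfiesT2 lam (π' ξ s)) :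
    0 ≤ ε ∧ ∫⁻ ξ, M.gap γ τ lam νs πs (π' ξ) ∂μ
      ≤ ENNReal.ofReal γ * M.gap γ τ lam νs πs π
        + ENNReal.ofReal ((η / 2 + 4 * |B| + 5) / (1 - γ) * (ε + σ)) := by
  have := hν.1
  have h1γ : 0 < 1 - γ := by linarith
  have hη₀ : 0 < η := lt_of_lt_of_le (by positivity) hη
  -- Nonnegativity of `ε` is read off from the bias bound at a single state and action.
  obtain ⟨s₀⟩ : Nonempty S := νs.nonempty_of_neZero
  obtain ⟨a₀, ha₀⟩ : M.actions.Nonempty := by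
    have := (hπ.1 s₀).isProb
    exact (hπ.1 s₀).ae_mem.exists
  have hε₀ : 0 ≤ ε := (abs_nonneg _).trans (hε s₀ a₀ ha₀)
  refine ⟨hε₀, ?_⟩
  have hFB' : ∀ᵐ ξ ∂μ, ∀ s, ∀ a ∈ M.actions, |F ξ s a| ≤ |B| :=
    hFB.mono fun ξ h s a ha => (h s a ha).trans (le_abs_self B)
  -- `Q` is within `ε` of an average of estimates bounded by `|B|`; this keeps the reward bound `R`
  -- out of the constant.
  have hQB : ∀ s, ∀ a ∈ M.actions, |M.qValue γ τ π s a| ≤ |B| + ε := by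
    intro s a ha
    have h1 : |∫ ξ, F ξ s a ∂μ| ≤ |B| := by
      simpa using norm_integral_le_of_norm_le_const (μ := μ) (f := fun ξ => F ξ s a)
        (hFB'.mono fun ξ h => h s a ha)
    have h2 := abs_le.1 (hε s a ha)
    have h3 := abs_le.1 h1
    exact abs_le.2 ⟨by linarith, by linarith⟩
  have hQm := hπ.measurable_qValue (τ := τ) hγ₀ hγ₁ hA hR
  have hb₁ := integrable_and_abs_integral_bias_le (νs := νs) hπ hF hQm hFB' hQB hε
  have hb₂ := integrable_and_abs_integral_bias_le (νs := νs) hopt.1 hF hQm hFB' hQB hε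
  set Z : Ξ → ℝ := fun ξ => ∫ s, ∫ a, (F ξ s a - M.qValue γ τ π s a) ∂(π s) ∂νs
    - ∫ s, ∫ a, (F ξ s a - M.qValue γ τ π s a) ∂(πs s) ∂νs with hZ
  have hZi : Integrable Z μ := hb₁.1.sub hb₂.1
  have hZle : ∫ ξ, Z ξ ∂μ ≤ 2 * ε := by
    rw [hZ, integral_sub hb₁.1 hb₂.1]
    linarith [(abs_le.1 hb₁.2).2, (abs_le.1 hb₂.2).1]
  have hK : 0 < (η / 2 + 4 * |B| + 1) / (1 - γ) := by positivity
  have hgap : M.gap γ τ lam νs πs π ≠ ∞ := gap_ne_top hA hπ hopt.1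
  have hmain := lintegral_le_of_noise (μ := μ) (G := fun ξ => M.gap γ τ lam νs πs (π' ξ))
    (a := γ * (M.gap γ τ lam νs πs π).toReal + 2 * ε / (1 - γ)) hZi hK hσ₀ hσ ?_
  · refine hmain.trans ?_
    have h1 : γ * (M.gap γ τ lam νs πs π).toReal + 2 * ε / (1 - γ) + ∫ ξ, Z ξ ∂μ
          + (η / 2 + 4 * |B| + 1) / (1 - γ) * σ
        ≤ γ * (M.gap γ τ lam νs πs π).toReal
          + (η / 2 + 4 * |B| + 5) / (1 - γ) * (ε + σ) := by
      have h2 : 2 * ε ≤ 2 * ε / (1 - γ) := le_div_self (by positivity) h1γ (by linarith)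
      -- The `5` is `1 + 4`: two units of `ε` come from `noise_error_le` and two from the bias
      -- against `π` and `πs`.
      have h3 : (η / 2 + 4 * |B| + 5) / (1 - γ) * (ε + σ)
          = (η / 2 + 4 * |B| + 1) / (1 - γ) * σ + 2 * ε / (1 - γ) + 2 * ε / (1 - γ)
            + ((η / 2 + 4 * |B| + 1) * ε + 4 * σ) / (1 - γ) := by ring
      have h4 : 0 ≤ ((η / 2 + 4 * |B| + 1) * ε + 4 * σ) / (1 - γ) := by positivity
      linarith
    refine (ENNReal.ofReal_le_ofReal h1).trans (ENNReal.ofReal_add_le.trans_eq ?_)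
    rw [ENNReal.ofReal_mul hγ₀.le, ENNReal.ofReal_toReal hgap]
  · filter_upwards [hFB', hFd, hprox, hT] with ξ h1 h2 h3 h4
    have hπ' : M.IsPolicy (π' ξ) := hπ.of_isProxStep hA hτ hη₀ h1 h3
    refine ⟨gap_ne_top hA hπ' hopt.1, fun hL => ?_⟩
    have hFm : Measurable fun p : S × Act d => F ξ p.1 p.2 := hF.comp measurable_prodMk_left
    have hstep := gap_step hγ₀ hγ₁ hτ hlam hη hA hR hopt hν hπ hπ' hFm h1 hQB h3 h4
      (noise_error_le hη₀ (abs_nonneg B) hAc hA hπ hπ'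
        (fun s => hFm.comp measurable_prodMk_left) (fun s => hQm.comp measurable_prodMk_left)
        h1 hQB h2 hQd hε₀ hL)
    refine hstep.trans_eq ?_
    simp only [hZ]
    ring

end MDP

end WPPG

end

/-! ### Iteration of the conditional contraction. -/

theorem theorem2 (γ τ lam η B : ℝ) (hγ0 : 0 < γ) (hγ1 : γ < 1) (hτ : 0 < τ) (hlam : 0 < lam)
    (hη : 1 / (γ * lam * τ) ≤ η) :
    -- the constant in `O(ε + σ)`: it depends on `γ, τ, lam, η, B` only
    ∃ C : ℝ, 0 ≤ C ∧
    ∀ {d : ℕ} {S : Type*} [MeasurableSpace S] (M : WPPG.MDP S d)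
      -- convex bounded action set, bounded reward
      (_ : Convex ℝ M.actions) (_ : Bornology.IsBounded M.actions)
      (_ : ∃ R : ℝ, ∀ s, ∀ a ∈ M.actions, |M.reward (s, a)| ≤ R)
      -- optimal policy and its stationary distribution
      (πs : Kernel S (WPPG.Act d)) (_ : M.IsOptimal γ τ πs)
      (νs : Measure S) (_ : M.IsStationary πs νs)
      -- sampling noise `ξ_k`, drawn from `κ k` given the past
      {Ξ : Type*} [MeasurableSpace Ξ]
      (κ : (k : ℕ) → Kernel (Fin k → Ξ) Ξ) (_ : ∀ k, IsMarkovKernel (κ k))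
      -- initial policy, and policies `π_k` as functions of `ξ_{0:k-1}`
      (π₀ : Kernel S (WPPG.Act d)) (_ : M.IsPolicy π₀)
      (π : (k : ℕ) → Kernel ((Fin k → Ξ) × S) (WPPG.Act d)) (_ : ∀ k, IsMarkovKernel (π k))
      (_ : ∀ h s, π 0 (h, s) = π₀ s)
      -- stochastic estimators of the Q-functions, as functions of `ξ_{0:k}`
      (Qhat : (k : ℕ) → (Fin (k + 1) → Ξ) → S → WPPG.Act d → ℝ)
      (_ : ∀ k, Measurable fun x : (Fin (k + 1) → Ξ) × S × WPPG.Act d =>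
        Qhat k x.1 x.2.1 x.2.2)
      -- they are uniformly bounded
      (_ : ∀ k, ∀ᵐ h ∂(WPPG.histLaw κ (k + 1)), ∀ s, ∀ a ∈ M.actions, |Qhat k h s a| ≤ B)
      -- differentiability in the action, so that `∇ₐ` makes sense
      (_ : ∀ k, ∀ᵐ h ∂(WPPG.histLaw κ (k + 1)), ∀ s, DifferentiableOn ℝ (Qhat k h s) M.actions)
      (_ : ∀ k, ∀ᵐ h ∂(WPPG.histLaw κ k), ∀ s,
        DifferentiableOn ℝ (M.qValue γ τ ((π k).sectR h) s) M.actions)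
      -- bias and mean square gradient error, the expectation being over `ξ_k` given `ξ_{0:k-1}`
      (ε σ : ℝ) (εs σs : ℕ → ℝ) (_ : ∀ k, εs k ≤ ε) (_ : ∀ k, 0 ≤ σs k ∧ σs k ≤ σ)
      (_ : ∀ k, ∀ᵐ h ∂(WPPG.histLaw κ k), ∀ s, ∀ a ∈ M.actions,
        |∫ ξ, Qhat k (WPPG.histSnoc h ξ) s a ∂(κ k h)
          - M.qValue γ τ ((π k).sectR h) s a| ≤ εs k)
      (_ : ∀ k, ∀ᵐ h ∂(WPPG.histLaw κ k),
        ∫⁻ ξ, WPPG.gradSupDist M.actions (Qhat k (WPPG.histSnoc h ξ))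
            (M.qValue γ τ ((π k).sectR h)) ^ 2 ∂(κ k h)
          ≤ ENNReal.ofReal (σs k ^ 2))
      -- the stochastic proximal update
      (_ : ∀ k, ∀ᵐ h ∂(WPPG.histLaw κ (k + 1)), ∀ s,
        WPPG.IsProxStep M.actions τ η (Qhat k h s)
          (π k (fun i => h i.castSucc, s)) (π (k + 1) (h, s)))
      -- uniform `T₂(lam)` along the trajectory
      (_ : ∀ k, ∀ᵐ h ∂(WPPG.histLaw κ k), ∀ s, WPPG.SatisfiesT2 lam (π k (h, s))),
      M.gap γ τ lam νs πs π₀ ≠ ∞ ∧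
      (∀ k : ℕ,
        ∫⁻ h, M.gap γ τ lam νs πs ((π k).sectR h) ∂(WPPG.histLaw κ k)
          ≤ ENNReal.ofReal (γ ^ k) * M.gap γ τ lam νs πs π₀ + ENNReal.ofReal (C * (ε + σ))) ∧
      -- iteration complexity
      (∀ δ : ℝ, 0 < δ → ∀ k : ℕ,
        1 / (1 - γ) * Real.log ((M.gap γ τ lam νs πs π₀).toReal / δ) ≤ k →
        ∫⁻ h, M.gap γ τ lam νs πs ((π k).sectR h) ∂(WPPG.histLaw κ k)
          ≤ ENNReal.ofReal (δ + C * (ε + σ))) := by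
  have h1γ : 0 < 1 - γ := by linarith
  have hη₀ : 0 < η := lt_of_lt_of_le (by positivity) hη
  -- The second division by `1 - γ` sums the one-step errors geometrically.
  refine ⟨(η / 2 + 4 * |B| + 5) / (1 - γ) / (1 - γ), by positivity, ?_⟩
  intro d S _ M hAc hA ⟨R, hR⟩ πs hopt νs hν Ξ _ κ _ π₀ hπ₀ π _ hπ0 Qhat hQm hQB hQd hQd' ε σ εs σs
    hεs hσs hbias hgrad hprox hT
  have := hν.1
  have hpol : ∀ k, ∀ᵐ h ∂(WPPG.histLaw κ k), M.IsPolicy ((π k).sectR h) := by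
    intro k
    induction k with
    | zero =>
      refine .of_forall fun h => ?_
      have e : (π 0).sectR h = π₀ := Kernel.ext fun s => hπ0 h s
      rwa [e]
    | succ k ih =>
      filter_upwards [WPPG.ae_histLaw_succ_of_ae ih, hQB k, hprox k] with h h1 h2 h3
      exact h1.of_isProxStep hA hτ hη₀ h2 h3
  have hσ₀ : 0 ≤ σ := (hσs 0).1.trans (hσs 0).2
  have hstep : ∀ k, ∀ᵐ h ∂(WPPG.histLaw κ k), 0 ≤ ε ∧
      ∫⁻ ξ, M.gap γ τ lam νs πs ((π (k + 1)).sectR (WPPG.histSnoc h ξ)) ∂(κ k h)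
        ≤ ENNReal.ofReal γ * M.gap γ τ lam νs πs ((π k).sectR h)
          + ENNReal.ofReal ((η / 2 + 4 * |B| + 5) / (1 - γ) * (ε + σ)) := by
    intro k
    filter_upwards [hpol k, WPPG.ae_ae_of_ae_histLaw_succ (hQB k),
      WPPG.ae_ae_of_ae_histLaw_succ (hQd k), hQd' k, hbias k, hgrad k,
      WPPG.ae_ae_of_ae_histLaw_succ (hprox k), WPPG.ae_ae_of_ae_histLaw_succ (hT (k + 1))]
      with h h1 h2 h3 h4 h5 h6 h7 h8
    refine WPPG.MDP.lintegral_gap_step_le (π' := fun ξ => (π (k + 1)).sectR (WPPG.histSnoc h ξ))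
      hγ0 hγ1 hτ hlam hη hAc hA hR hopt hν h1
      (F := fun ξ => Qhat k (WPPG.histSnoc h ξ)) ?_ h2 h3 h4
      (fun s a ha => (h5 s a ha).trans (hεs k)) hσ₀
      (h6.trans (ENNReal.ofReal_le_ofReal (pow_le_pow_left₀ (hσs k).1 (hσs k).2 2))) ?_ h8
    · exact (hQm k).comp ((((WPPG.measurable_histSnoc k).comp measurable_prodMk_left).comp
        measurable_fst).prodMk measurable_snd)
    · filter_upwards [h7] with ξ h7 s
      have h9 := h7 s
      rwa [WPPG.histSnoc_castSucc] at h9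
  -- An almost sure statement under a probability measure holds at some history.
  have hε₀ : 0 ≤ ε := (hstep 0).exists.choose_spec.1
  have hgap₀ : M.gap γ τ lam νs πs π₀ ≠ ∞ := WPPG.MDP.gap_ne_top hA hπ₀ hopt.1
  have hzero : ∫⁻ h, M.gap γ τ lam νs πs ((π 0).sectR h) ∂(WPPG.histLaw κ 0)
      = M.gap γ τ lam νs πs π₀ := by
    have e : ∀ h, (π 0).sectR h = π₀ := fun h => Kernel.ext fun s => hπ0 h s
    simp [e]
  have hrate : ∀ k : ℕ, ∫⁻ h, M.gap γ τ lam νs πs ((π k).sectR h) ∂(WPPG.histLaw κ k)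
      ≤ ENNReal.ofReal (γ ^ k) * M.gap γ τ lam νs πs π₀
        + ENNReal.ofReal ((η / 2 + 4 * |B| + 5) / (1 - γ) / (1 - γ) * (ε + σ)) := by
    intro k
    have h := WPPG.le_pow_mul_add_of_le_mul_add hγ0 hγ1
      (c := (η / 2 + 4 * |B| + 5) / (1 - γ) * (ε + σ)) (by positivity)
      (a := fun k => ∫⁻ h, M.gap γ τ lam νs πs ((π k).sectR h) ∂(WPPG.histLaw κ k)) (fun k => ?_) k
    · rw [hzero] at h
      refine h.trans_eq ?_
      congr 2
      ring
    · refine (WPPG.lintegral_histLaw_succ_le _).trans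
        ((lintegral_mono_ae ((hstep k).mono fun h h1 => h1.2)).trans_eq ?_)
      rw [lintegral_add_right _ measurable_const, lintegral_const_mul' _ _ ENNReal.ofReal_ne_top]
      simp
  refine ⟨hgap₀, hrate, fun δ hδ k hk => (hrate k).trans ?_⟩
  rw [ENNReal.ofReal_add hδ.le (by positivity)]
  gcongr
  rw [← ENNReal.ofReal_toReal hgap₀, ← ENNReal.ofReal_mul (by positivity)]
  exact ENNReal.ofReal_le_ofReal
    (WPPG.pow_mul_le_of_log_le hγ0 hγ1 ENNReal.toReal_nonneg hδ hk)
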